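/- **Setting.** Let $X$ be a compact metrizable space. A *Kuranishi chart* $C_p$ of $X$ based at $p\in X$ consists of a finite group $G_p$ acting smoothly and effectively on a smooth finite rank vector bundle $E_p\to V_p$ over a manifold with corners, a smooth equivariant section $s_p$, and a homeomorphism $\psi_p$ from the orbit space $\underline{s_p^{-1}(0)}$ onto an open neighbourhood $X_p$ of $p$ (underlining denotes orbit spaces). For $U\subset V_p$ open and invariant, $C_p|_U$ is the restricted chart, with coverage $X_p|_U=\psi_p(\underline{s_p^{-1}(0)\cap U})$. A *coordinate change* $(\phi,\hat\phi)$ from one chart to another is an equivariant bundle embedding, defined over an open invariant subset (its domain), with respect to an injective group homomorphism inducing isomorphisms of stabilizers, injective on orbit spaces, which intertwines the sections and the maps $\psi$ and is such that the normal linearization of the target section induces an isomorphism from the normal bundle of the image of $\phi$ to the quotient of the target bundle by the image of $\hat\phi$, at all zeros in the image of $\phi$. Three coordinate changes are *compatible* if on the common domain the composition of two equals the third up to one element of the group of the target. A *Kuranishi structure* $\mathcal K$ on $X$ consists of charts $C_p$, $p\in X$, and coordinate changes $\phi_{pq}:C_q\to C_p$ for all $q\in X_p$, with domain $V_{pq}\subset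 V_q$ covering $q$, which are compatible and satisfy, with $\sim_{\mathcal K}$ the equivalence relation on $\bigsqcup_p\underline{V_p}$ generated by the maps $\underline{\phi_{pq}}$: (maximality) if $q\in X_p$, $z\in V_q$, $z'\in V_p$, $\underline z\sim_{\mathcal K}\underline{z'}$, then $z\in V_{pq}$ and $\underline{\phi_{pq}}(\underline z)=\underline{z'}$; (topological matching) if $v_n\to v$ in $\underline{V_p}$, $v_n'\to v'$ in $\underline{V_{p'}}$, $v_n\sim_{\mathcal K}v'_n$ and $v,v'$ lie in the orbit spaces of the zero sets, then $v\sim_{\mathcal K}v'$. Put $M(\mathcal K)=\bigsqcup_p\underline{V_p}/\!\sim_{\mathcal K}$. A *good coordinate system $\mathcal G$ for $\mathcal K$* consists of a finite $S\subset X$ with a reflexive, transitive, total relation $\le$, restricted charts $C_x|_{U_x}$, $x\in S$, each covering $x$, whose coverages $X_x|_{U_x}$ cover $X$ and such that $\operatorname{rank}E_y<\operatorname{rank}E_x$ implies $y\le x$ and $x\not\le y$, and exactly one coordinate change $C_y|_{U_y}\to C_x|_{U_x}$ for each $(y,x)$ in $I(\mathcal G)=\{y\le x,\ X_y|_{U_y}\cap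 X_x|_{U_x}\neq\emptyset\}$, whose domain contains all zeros in $U_y$ lying over $X_y|_{U_y}\cap X_x|_{U_x}$. These are compatible and satisfy maximality and topological matching for the relation $\sim_{\mathcal G}$ that they generate on $\bigsqcup_{x\in S}\underline{U_x}$. If $y\in X_x$ the coordinate change is restricted from $\phi_{xy}$ in $\mathcal K$; otherwise it is the inverse of the restriction of $\phi_{yx}$ in $\mathcal K$, across which the dimension and the group order do not change. Put $M(\mathcal G)=\bigsqcup_{x\in S}\underline{U_x}/\!\sim_{\mathcal G}$. Call $\mathcal G$ *regular* if each $X_x|_{U_x}$ is the interior of its closure in $X$; *strongly intersecting* if $X_y|_{U_y}\cap X_x|_{U_x}\ne\emptyset$ whenever $\underline{U_y}$ and $\underline{U_x}$ meet in $M(\mathcal K)$ (so that there already is a direct coordinate change between the two charts); and *identification-matching* if $M(\mathcal G)=M(\mathcal K)|_{\mathcal G}$, i.e. $\sim_{\mathcal G}$ and $\sim_{\mathcal K}$ agree on $\bigsqcup_{x\in S}\underline{U_x}$. A *shrinking* $\mathcal G'$ of $\mathcal G$ is a good coordinate system with the same $(S,\le)$, smaller $U'_x\subset U_x$, $I(\mathcal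 G')=I(\mathcal G)$, and restricted coordinate changes; it is *precompact* if it is regular and $\overline{U'_x}$ is compact in $U_x$ for all $x\in S$. A *strong shrinking sequence* of $\mathcal G$ is a sequence of shrinkings $\mathcal G(k)=\{C_x|_{U_x(k)}\}$, $k\ge1$, of $\mathcal G$ such that $\mathcal G(1)$ is precompact in $\mathcal G$, $\mathcal G(k+1)$ is a precompact shrinking of $\mathcal G(k)$, and $\bigcap_k\overline{U_x(k)}\subset\overline{s_x^{-1}(0)\cap U_x(1)}$ for all $x\in S$. *Relative topology.* Let $\mathcal G'$ be a good coordinate system with index set $S$ and bases $U'_x$, and let $W_x\supset U'_x$ with an equivalence relation on $\bigsqcup_{x\in S}\underline{W_x}$ be the bases and the relation $\sim_{\mathcal G}$ of a system $\mathcal G$ of which $\mathcal G'$ is a shrinking, respectively $W_x=V_x$ and $\sim_{\mathcal K}$. For $z\in M(\mathcal G')$ let $J_z$ be the set of $x\in S$ such that $z$ is represented by a point of the closure of $\underline{U'_x}$ in $\underline{W_x}$, and let $x$ be a largest element of $J_z$. Let $D_x$ be $\underline{W_x}$ minus the closures of the sets of points identified with a point of $\underline{U'_y}$, for all $y\in S$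 with $x\le y$, $y\not\le x$ and $X_x|_{W_x}\cap X_y|_{U'_y}\ne\emptyset$. The basic neighbourhoods of $z$ are the sets of all points of $M(\mathcal G')$ represented in $O$, for $O\subset D_x$ open such that $z$ is represented in $O$. A subset of $M(\mathcal G')$ is open if it is a neighbourhood, in this sense, of each of its points. This is $\mathcal T(\mathcal G',\mathcal G)$, respectively $\mathcal T(\mathcal G',\mathcal K)$. It is called *well defined* if every $J_z$ has a largest element and for every choice of one the basic neighbourhoods of $z$ form a neighbourhood base at $z$. **Theorem.** Let $\mathcal K$ be a Kuranishi structure on $X$. 1. Every regular good coordinate system $\mathcal G$ for $\mathcal K$ has a regular, strongly intersecting shrinking $\mathcal G'$ that is a good coordinate system for $\mathcal K$, with $x\in X_x|_{U'_x}$ and $\overline{X_x|_{U'_x}}\subset X_x|_{U_x}$ for all $x\in S$. 2. There is a good coordinate system for $\mathcal K$ that is identification-matching, strongly intersecting and regular. 3. Let $\mathcal G$ be as in 2. Strong shrinking sequences of $\mathcal G$ exist, and for each of them and all sufficiently large $k$: $\mathcal G(k)$ is a strongly intersecting, identification-matching good coordinate system for $\mathcal K$, the topologies $\mathcal T(\mathcal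 G(k),\mathcal G)$ and $\mathcal T(\mathcal G(k),\mathcal K)$ on $M(\mathcal G(k))$ are well defined and coincide, and they are Hausdorff. 4. Consequently there is a strongly intersecting, identification-matching good coordinate system $\mathcal G$ for $\mathcal K$ such that $\mathcal T(\mathcal G,\mathcal K)$ is well defined and $M(\mathcal G)$ is Hausdorff in it. -/

import Mathlib

open Set Filter Topology Bundle
open scoped Manifold ContDiff

universe u v

/-- A Kuranishi chart of `X` based at `p`: a finite group `G` acting smoothly and effectively on a
smooth vector bundle `E → V` of rank `rank` over a (Hausdorff, second countable) manifold with
corners `V` of dimension `dim`, a smooth equivariant section `s`, and a homeomorphism `ψ` of the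
orbit space of the zero set of `s` onto an open neighbourhood of `p`.  The action of `g` on `E` is
given by its fibre maps `act g v : E v → E (g • v)`. -/
structure KuranishiChart (X : Type u) [TopologicalSpace X] (p : X) where
  G : Type v
  [group : Group G]
  [finite : Finite G]
  dim : ℕ
  V : Type v
  [topV : TopologicalSpace V]
  [t2V : T2Space V]
  [sndV : SecondCountableTopology V]
  [chartedV : ChartedSpace (EuclideanQuadrant dim) V]
  [smoothV : IsManifold (modelWithCornersEuclideanQuadrant dim) ∞ V]
  rank : ℕ
  E : V → Type v
  [topE : ∀ v, TopologicalSpace (E v)]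
  [addE : ∀ v, AddCommGroup (E v)]
  [modE : ∀ v, Module ℝ (E v)]
  [topTotal : TopologicalSpace (TotalSpace (EuclideanSpace ℝ (Fin rank)) E)]
  [fiberE : FiberBundle (EuclideanSpace ℝ (Fin rank)) E]
  [vectorE : VectorBundle ℝ (EuclideanSpace ℝ (Fin rank)) E]
  [smoothE : ContMDiffVectorBundle ∞ (EuclideanSpace ℝ (Fin rank)) E
    (modelWithCornersEuclideanQuadrant dim)]
  [mulAction : MulAction G V]
  act : ∀ (g : G) (v : V), E v →ₗ[ℝ] E (g • v)
  act_one : ∀ (v : V) (e : E v),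
    (⟨(1 : G) • v, act 1 v e⟩ : TotalSpace (EuclideanSpace ℝ (Fin rank)) E) = ⟨v, e⟩
  act_mul : ∀ (g h : G) (v : V) (e : E v),
    (⟨(g * h) • v, act (g * h) v e⟩ : TotalSpace (EuclideanSpace ℝ (Fin rank)) E) =
      ⟨g • h • v, act g (h • v) (act h v e)⟩
  smooth_smul : ∀ g : G, ContMDiff (modelWithCornersEuclideanQuadrant dim)
    (modelWithCornersEuclideanQuadrant dim) ∞ (fun v : V => g • v)
  smooth_act : ∀ g : G,
    ContMDiff
      ((modelWithCornersEuclideanQuadrant dim).prod 𝓘(ℝ, EuclideanSpace ℝ (Fin rank)))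
      ((modelWithCornersEuclideanQuadrant dim).prod 𝓘(ℝ, EuclideanSpace ℝ (Fin rank))) ∞
      (fun e : TotalSpace (EuclideanSpace ℝ (Fin rank)) E =>
        (⟨g • e.1, act g e.1 e.2⟩ : TotalSpace (EuclideanSpace ℝ (Fin rank)) E))
  effective : ∀ g : G,
    (∀ (v : V) (e : E v),
      (⟨g • v, act g v e⟩ : TotalSpace (EuclideanSpace ℝ (Fin rank)) E) = ⟨v, e⟩) → g = 1
  s : ∀ v, E v
  smooth_s : ContMDiff (modelWithCornersEuclideanQuadrant dim)
    ((modelWithCornersEuclideanQuadrant dim).prod 𝓘(ℝ, EuclideanSpace ℝ (Fin rank))) ∞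
    (fun v => (⟨v, s v⟩ : TotalSpace (EuclideanSpace ℝ (Fin rank)) E))
  equivariant_s : ∀ (g : G) (v : V), act g v (s v) = s (g • v)
  ψ : {a : MulAction.orbitRel.Quotient G V //
    ∃ v : V, s v = 0 ∧ (Quotient.mk'' v : MulAction.orbitRel.Quotient G V) = a} → X
  isOpenEmbedding_ψ : IsOpenEmbedding ψ
  base_mem : p ∈ range ψ

namespace KuranishiChart

attribute [instance] group finite topV t2V sndV chartedV smoothV topE addE modE topTotal fiberE
  vectorE smoothE mulAction

variable {X : Type u} [TopologicalSpace X] {p : X} (C : KuranishiChart.{u, v} X p)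

/-- The standard fibre of the bundle. -/
abbrev F : Type := EuclideanSpace ℝ (Fin C.rank)

/-- The total space of the bundle. -/
abbrev Tot : Type v := TotalSpace C.F C.E

/-- The model with corners of the base. -/
abbrev I : ModelWithCorners ℝ (EuclideanSpace ℝ (Fin C.dim)) (EuclideanQuadrant C.dim) :=
  modelWithCornersEuclideanQuadrant C.dim

/-- The orbit space of the base, with the quotient topology. -/
abbrev Q : Type v := MulAction.orbitRel.Quotient C.G C.V

/-- The quotient map to the orbit space. -/
def quot (v : C.V) : C.Q := Quotient.mk'' v

/-- The orbit space of an invariant subset `U`, as a subset of the orbit space. -/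
def orb (U : Set C.V) : Set C.Q := C.quot '' U

/-- The action of a group element on the total space. -/
def smulTot (g : C.G) (e : C.Tot) : C.Tot := ⟨g • e.1, C.act g e.1 e.2⟩

/-- Invariance of a subset of the base. -/
def Invariant (U : Set C.V) : Prop := ∀ (g : C.G), ∀ v ∈ U, g • v ∈ U

/-- The zero set of the section. -/
def zeros : Set C.V := {v | C.s v = 0}

/-- The point of `X` that corresponds to a zero of the section. -/
def foot (v : C.V) (hv : v ∈ C.zeros) : X := C.ψ ⟨C.quot v, v, hv, rfl⟩

/-- The coverage on `X` of the chart restricted to `U`. -/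
def cov (U : Set C.V) : Set X := {a | ∃ (v : C.V) (hv : v ∈ C.zeros), v ∈ U ∧ C.foot v hv = a}

/-- The linearization `T_v V → E_v` of the section, computed in the local trivialization at `v`.
It is used only at zeros `v` of the section, where it is independent of the trivialization (and is
the value of `∇ s` for any connection `∇`). -/
noncomputable def lin (v : C.V) : TangentSpace C.I v →ₗ[ℝ] C.E v :=
  ((trivializationAt C.F C.E v).symmₗ ℝ v).comp
    (mfderiv C.I 𝓘(ℝ, C.F) (fun w => ((trivializationAt C.F C.E v) (⟨w, C.s w⟩ : C.Tot)).2)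
      v).toLinearMap

/-- The normal linearization of the section at `v`, with respect to a subspace `T` of the tangent
space and a subspace `E'` of the fibre, is defined and is an isomorphism `T_v V / T → E_v / E'`. -/
def NormalIso (v : C.V) (T : Submodule ℝ (TangentSpace C.I v)) (E' : Submodule ℝ (C.E v)) : Prop :=
  ∃ hle : T ≤ E'.comap (C.lin v), Function.Bijective (Submodule.mapQ T E' (C.lin v) hle)

end KuranishiChart

/-- A coordinate change from the restricted chart `C|_U` to the restricted chart `D|_W`: an
embedding of equivariant vector bundles, from the restriction of the bundle of `C` to an open
invariant `dom ⊆ U` into the bundle of `D` over `W`, that intertwines the sections and the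
identifications with `X` and satisfies the tangent bundle condition.  The values of `φ` and `φhat`
outside `dom` have no meaning. -/
structure CoordChange {X : Type u} [TopologicalSpace X] {q p : X} (C : KuranishiChart.{u, v} X q)
    (D : KuranishiChart.{u, v} X p) (U : Set C.V) (W : Set D.V) where
  dom : Set C.V
  dom_subset : dom ⊆ U
  isOpen_dom : IsOpen dom
  invariant_dom : C.Invariant dom
  φ : C.V → D.V
  φhat : ∀ v : C.V, C.E v →ₗ[ℝ] D.E (φ v)
  mapsTo : MapsTo φ dom W
  smooth_φ : ContMDiffOn C.I D.I ∞ φ dom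
  isEmbedding_φ : IsEmbedding (dom.domRestrict φ)
  injective_mfderiv : ∀ v ∈ dom, Function.Injective (mfderiv C.I D.I φ v)
  smooth_φhat : ContMDiffOn (C.I.prod 𝓘(ℝ, C.F)) (D.I.prod 𝓘(ℝ, D.F)) ∞
    (fun e : C.Tot => (⟨φ e.1, φhat e.1 e.2⟩ : D.Tot)) {e | e.1 ∈ dom}
  injective_φhat : ∀ v ∈ dom, Function.Injective (φhat v)
  -- equivariance with respect to an injective homomorphism, isomorphic on stabilizers
  equivariant : ∃ h : C.G →* D.G, Function.Injective h ∧
    (∀ (g : C.G), ∀ v ∈ dom, ∀ e : C.E v,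
      (⟨φ (g • v), φhat (g • v) (C.act g v e)⟩ : D.Tot) = D.smulTot (h g) ⟨φ v, φhat v e⟩) ∧
    (∀ v ∈ dom, (MulAction.stabilizer C.G v).map h = MulAction.stabilizer D.G (φ v))
  -- injectivity on orbit spaces
  injective_orb : ∀ v ∈ dom, ∀ w ∈ dom, D.quot (φ v) = D.quot (φ w) → C.quot v = C.quot w
  map_s : ∀ v ∈ dom, φhat v (C.s v) = D.s (φ v)
  map_foot : ∀ v ∈ dom, ∀ (hv : v ∈ C.zeros) (hw : φ v ∈ D.zeros), D.foot (φ v) hw = C.foot v hv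
  -- tangent bundle condition: the normal linearization
  -- `T V_D / dφ (T V_C) → E_D / φhat (E_C)` is an isomorphism over the zeros
  tangent : ∀ v ∈ dom, v ∈ C.zeros →
    D.NormalIso (φ v) (mfderiv C.I D.I φ v).toLinearMap.range (φhat v).range

namespace CoordChange

variable {X : Type u} [TopologicalSpace X] {r q p : X} {B : KuranishiChart.{u, v} X r}
  {C : KuranishiChart.{u, v} X q} {D : KuranishiChart.{u, v} X p}

/-- The bundle map on total spaces. -/
def hat {U : Set C.V} {W : Set D.V} (Φ : CoordChange C D U W) (e : C.Tot) : D.Tot :=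
  ⟨Φ.φ e.1, Φ.φhat e.1 e.2⟩

/-- Compatibility of `B → C`, `C → D` and `B → D`: the composition agrees with the direct
coordinate change on the common domain, up to the action of one element of the group of `D`. -/
def Compatible {U₁ U₂ : Set B.V} {W₁ W₂ : Set C.V} {Z₁ Z₂ : Set D.V} (Φ : CoordChange B C U₁ W₁)
    (Ψ : CoordChange C D W₂ Z₁) (Θ : CoordChange B D U₂ Z₂) : Prop :=
  ∃ g : D.G, ∀ v ∈ Θ.dom ∩ Φ.dom ∩ Φ.φ ⁻¹' Ψ.dom, ∀ e : B.E v,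
    Ψ.hat (Φ.hat ⟨v, e⟩) = D.smulTot g (Θ.hat ⟨v, e⟩)

/-- `Ψ` is restricted from `Φ`. -/
def IsRestriction {U U' : Set C.V} {W W' : Set D.V} (Ψ : CoordChange C D U' W')
    (Φ : CoordChange C D U W) : Prop :=
  Ψ.dom = Φ.dom ∩ Φ.φ ⁻¹' W' ∩ U' ∧ ∀ v ∈ Ψ.dom, ∀ e : C.E v, Ψ.hat ⟨v, e⟩ = Φ.hat ⟨v, e⟩

/-- `Ψ : D|_{W'} → C|_{U'}` is the inverse of the restriction of `Φ : C → D` to a coordinate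
change from `C|_{U'}` to `D|_{W'}`. -/
def IsInverseOfRestriction {U U' : Set C.V} {W W' : Set D.V} (Ψ : CoordChange D C W' U')
    (Φ : CoordChange C D U W) : Prop :=
  Ψ.dom = Φ.φ '' (Φ.dom ∩ Φ.φ ⁻¹' W' ∩ U') ∧
    ∀ v ∈ Φ.dom ∩ Φ.φ ⁻¹' W' ∩ U', ∀ e : C.E v, Ψ.hat (Φ.hat ⟨v, e⟩) = ⟨v, e⟩

end CoordChange

section Kuranishi

variable {X : Type u} [TopologicalSpace X]

/-- The disjoint union of the orbit spaces of a family of charts. -/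
abbrev ChartPoint (chart : ∀ p : X, KuranishiChart.{u, v} X p) : Type (max u v) :=
  Σ p : X, (chart p).Q

/-- The data of a Kuranishi structure: a chart at each point and, for each `q` in the coverage of
the chart at `p`, a coordinate change from the chart at `q` to the chart at `p` whose domain still
covers `q`. -/
structure KuranishiData (X : Type u) [TopologicalSpace X] where
  chart : ∀ p : X, KuranishiChart.{u, v} X p
  change : ∀ p q : X, q ∈ (chart p).cov univ → CoordChange (chart q) (chart p) univ univ
  base_mem_dom : ∀ (p q : X) (h : q ∈ (chart p).cov univ), q ∈ (chart q).cov (change p q h).dom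

/-- One quotiented coordinate change. -/
def KuranishiData.Step (K : KuranishiData.{u, v} X) (a b : ChartPoint K.chart) : Prop :=
  ∃ (p q : X) (h : q ∈ (K.chart p).cov univ), ∃ v ∈ (K.change p q h).dom,
    a = ⟨q, (K.chart q).quot v⟩ ∧ b = ⟨p, (K.chart p).quot ((K.change p q h).φ v)⟩

/-- The relation `∼`: connected by a sequence of quotiented coordinate changes, each moving in
either direction.  The identification space `M(K)` is the quotient by it. -/
def KuranishiData.ident (K : KuranishiData.{u, v} X) : Setoid (ChartPoint K.chart) :=
  Relation.EqvGen.setoid K.Step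

/-- A Kuranishi structure on `X`. -/
structure KuranishiStructure (X : Type u) [TopologicalSpace X] extends KuranishiData.{u, v} X where
  compatible : ∀ (p q r : X) (hqp : q ∈ (chart p).cov univ) (hrq : r ∈ (chart q).cov univ)
    (hrp : r ∈ (chart p).cov univ),
    (change q r hrq).Compatible (change p q hqp) (change p r hrp)
  maximality : ∀ (p q : X) (h : q ∈ (chart p).cov univ) (z : (chart q).V) (z' : (chart p).V),
    toKuranishiData.ident ⟨q, (chart q).quot z⟩ ⟨p, (chart p).quot z'⟩ →
    z ∈ (change p q h).dom ∧ (chart p).quot ((change p q h).φ z) = (chart p).quot z'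
  topologicalMatching : ∀ (p p' : X) (a : (chart p).Q) (a' : (chart p').Q),
    a ∈ (chart p).orb (chart p).zeros → a' ∈ (chart p').orb (chart p').zeros →
    (∃ (x : ℕ → (chart p).Q) (x' : ℕ → (chart p').Q),
      (∀ n, toKuranishiData.ident ⟨p, x n⟩ ⟨p', x' n⟩) ∧
      Tendsto x atTop (𝓝 a) ∧ Tendsto x' atTop (𝓝 a')) →
    toKuranishiData.ident ⟨p, a⟩ ⟨p', a'⟩

/-- The data of a good coordinate system whose charts are the restrictions `C_x|_{U_x}`, `x ∈ S`,
of the members of a given family of charts.  Only the restriction of `le` to `S` and the `U x` with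
`x ∈ S` have a meaning.  There is a coordinate change from the chart at `y` to the chart at `x`
exactly when `y ≤ x` and the coverages of the two charts meet. -/
structure GCSData (chart : ∀ p : X, KuranishiChart.{u, v} X p) where
  S : Set X
  le : X → X → Prop
  U : ∀ x : X, Set (chart x).V
  change : ∀ y ∈ S, ∀ x ∈ S, le y x → ((chart y).cov (U y) ∩ (chart x).cov (U x)).Nonempty →
    CoordChange (chart y) (chart x) (U y) (U x)

namespace GCSData

variable {chart : ∀ p : X, KuranishiChart.{u, v} X p} (G : GCSData chart)

/-- The coverage on `X` of the chart at `x`. -/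
def cov (x : X) : Set X := (chart x).cov (G.U x)

/-- One quotiented coordinate change of the good coordinate system. -/
def Step (a b : ChartPoint chart) : Prop :=
  ∃ (y : X) (hy : y ∈ G.S) (x : X) (hx : x ∈ G.S) (hle : G.le y x)
    (hne : (G.cov y ∩ G.cov x).Nonempty), ∃ v ∈ (G.change y hy x hx hle hne).dom,
    a = ⟨y, (chart y).quot v⟩ ∧ b = ⟨x, (chart x).quot ((G.change y hy x hx hle hne).φ v)⟩

/-- The relation `∼` of the good coordinate system; on points outside the charts of the good
coordinate system it is the identity. -/
def ident : Setoid (ChartPoint chart) := Relation.EqvGen.setoid G.Step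

/-- The disjoint union of the orbit spaces of the charts of the good coordinate system. -/
def Pt : Type (max u v) := {a : ChartPoint chart // a.1 ∈ G.S ∧ a.2 ∈ (chart a.1).orb (G.U a.1)}

/-- The identification space `M(G)`. -/
def M : Type (max u v) := Quotient (G.ident.comap (Subtype.val : G.Pt → ChartPoint chart))

/-- The point of `M(G)` given by a point of a chart. -/
def toM (a : G.Pt) : G.M := Quotient.mk _ a

end GCSData

/-- A good coordinate system for `X`, with charts restricted from a given family of charts. -/
structure GoodCoordinateSystem (chart : ∀ p : X, KuranishiChart.{u, v} X p)
    extends GCSData chart where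
  finite_S : S.Finite
  le_refl : ∀ x ∈ S, le x x
  le_trans : ∀ x ∈ S, ∀ y ∈ S, ∀ z ∈ S, le x y → le y z → le x z
  le_total : ∀ x ∈ S, ∀ y ∈ S, le x y ∨ le y x
  isOpen_U : ∀ x ∈ S, IsOpen (U x)
  invariant_U : ∀ x ∈ S, (chart x).Invariant (U x)
  base_mem : ∀ x ∈ S, x ∈ (chart x).cov (U x)
  cover : ∀ a : X, ∃ x ∈ S, a ∈ (chart x).cov (U x)
  le_of_rank_lt : ∀ y ∈ S, ∀ x ∈ S, (chart y).rank < (chart x).rank → le y x ∧ ¬ le x y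
  foot_dom : ∀ (y : X) (hy : y ∈ S) (x : X) (hx : x ∈ S) (hle : le y x)
    (hne : ((chart y).cov (U y) ∩ (chart x).cov (U x)).Nonempty) (z : (chart y).V)
    (hz : z ∈ (chart y).zeros), z ∈ U y →
    (chart y).foot z hz ∈ (chart y).cov (U y) ∩ (chart x).cov (U x) →
    z ∈ (change y hy x hx hle hne).dom
  compatible : ∀ (z : X) (hz : z ∈ S) (y : X) (hy : y ∈ S) (x : X) (hx : x ∈ S)
    (hzy : le z y) (nzy : ((chart z).cov (U z) ∩ (chart y).cov (U y)).Nonempty)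
    (hyx : le y x) (nyx : ((chart y).cov (U y) ∩ (chart x).cov (U x)).Nonempty)
    (hzx : le z x) (nzx : ((chart z).cov (U z) ∩ (chart x).cov (U x)).Nonempty),
    (change z hz y hy hzy nzy).Compatible (change y hy x hx hyx nyx) (change z hz x hx hzx nzx)
  maximality : ∀ (y : X) (hy : y ∈ S) (x : X) (hx : x ∈ S) (hle : le y x)
    (hne : ((chart y).cov (U y) ∩ (chart x).cov (U x)).Nonempty),
    ∀ z ∈ U y, ∀ z' ∈ U x,
    toGCSData.ident ⟨y, (chart y).quot z⟩ ⟨x, (chart x).quot z'⟩ →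
    z ∈ (change y hy x hx hle hne).dom ∧
      (chart x).quot ((change y hy x hx hle hne).φ z) = (chart x).quot z'
  topologicalMatching : ∀ y ∈ S, ∀ x ∈ S, ∀ (a : (chart y).Q) (a' : (chart x).Q),
    a ∈ (chart y).orb ((chart y).zeros ∩ U y) → a' ∈ (chart x).orb ((chart x).zeros ∩ U x) →
    (∃ (w : ℕ → (chart y).Q) (w' : ℕ → (chart x).Q),
      (∀ n, w n ∈ (chart y).orb (U y)) ∧ (∀ n, w' n ∈ (chart x).orb (U x)) ∧
      (∀ n, toGCSData.ident ⟨y, w n⟩ ⟨x, w' n⟩) ∧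
      Tendsto w atTop (𝓝 a) ∧ Tendsto w' atTop (𝓝 a')) →
    toGCSData.ident ⟨y, a⟩ ⟨x, a'⟩

namespace GoodCoordinateSystem

section General

variable {chart : ∀ p : X, KuranishiChart.{u, v} X p}

/-- Every coverage is the interior of its closure. -/
def RegularCoverage (G : GoodCoordinateSystem chart) : Prop :=
  ∀ x ∈ G.S, G.cov x = interior (closure (G.cov x))

/-- `G'` is a shrinking of `G`. -/
def IsShrinking (G' G : GoodCoordinateSystem chart) : Prop :=
  G'.S = G.S ∧
  (∀ x ∈ G.S, ∀ y ∈ G.S, (G'.le y x ↔ G.le y x)) ∧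
  (∀ x ∈ G.S, G'.U x ⊆ G.U x) ∧
  (∀ x ∈ G.S, ∀ y ∈ G.S, (G.cov y ∩ G.cov x).Nonempty → (G'.cov y ∩ G'.cov x).Nonempty) ∧
  ∀ (y : X) (hy : y ∈ G.S) (hy' : y ∈ G'.S) (x : X) (hx : x ∈ G.S) (hx' : x ∈ G'.S)
    (hle : G.le y x) (hle' : G'.le y x) (hne : (G.cov y ∩ G.cov x).Nonempty)
    (hne' : (G'.cov y ∩ G'.cov x).Nonempty),
    (G'.change y hy' x hx' hle' hne').IsRestriction (G.change y hy x hx hle hne)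

/-- `G'` is a precompact shrinking of `G`. -/
def IsPrecompactShrinking (G' G : GoodCoordinateSystem chart) : Prop :=
  G'.IsShrinking G ∧
  (∀ x ∈ G.S, IsCompact (closure (G'.U x)) ∧ closure (G'.U x) ⊆ G.U x) ∧
  G'.RegularCoverage

/-- `H 0, H 1, …` is a strong shrinking sequence of `G` (with `H k` in place of the usual
`G(k + 1)`). -/
def IsStrongShrinkingSeq (H : ℕ → GoodCoordinateSystem chart) (G : GoodCoordinateSystem chart) :
    Prop :=
  (∀ k, (H k).IsShrinking G) ∧
  (H 0).IsPrecompactShrinking G ∧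
  (∀ k, (H (k + 1)).IsPrecompactShrinking (H k)) ∧
  ∀ x ∈ G.S, (⋂ k, closure ((H k).U x)) ⊆ closure ((chart x).zeros ∩ (H 0).U x)

/-! The relative topology on `M(G)`, relative to a background: the charts `C_x|_{W x}`, `x ∈ S`,
which contain those of `G`, and the relation `R` that identifies points of the charts of the
background. -/

section Relative

variable (G : GoodCoordinateSystem chart) (W : ∀ x : X, Set (chart x).V)
  (R : Setoid (ChartPoint chart))

/-- The point `z` of `M(G)` is the image of the point `a` of a chart of the background. -/
def Represents (z : G.M) (a : ChartPoint chart) : Prop := ∃ b : G.Pt, G.toM b = z ∧ R b.1 a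

/-- The set `J_z` of all `x ∈ S` such that `z` lies in the image of the closure of the orbit space
of `U x`, taken in the orbit space of `W x`. -/
def closureIndices (z : G.M) : Set X :=
  {x | x ∈ G.S ∧ ∃ a ∈ closure ((chart x).orb (G.U x)) ∩ (chart x).orb (W x),
    G.Represents R z ⟨x, a⟩}

/-- `x` is a largest element of `J_z`. -/
def IsTopIndex (z : G.M) (x : X) : Prop :=
  x ∈ G.closureIndices W R z ∧ ∀ y ∈ G.closureIndices W R z, G.le y x

/-- The domain, in the orbit space of `W x`, of the coordinate change from `C_x|_{W x}` to
`C_y|_{U y}` that is determined by maximality. -/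
def jumpDomain (y x : X) : Set (chart x).Q :=
  {a | a ∈ (chart x).orb (W x) ∧ ∃ b ∈ (chart y).orb (G.U y), R ⟨x, a⟩ ⟨y, b⟩}

/-- The set `D_x`: the orbit space of `W x` minus the closures of the domains of the coordinate
changes to the charts of strictly larger order whose coverage meets that of `C_x|_{W x}`. -/
def baseDomain (x : X) : Set (chart x).Q :=
  (chart x).orb (W x) \
    ⋃ y ∈ {y | y ∈ G.S ∧ G.le x y ∧ ¬ G.le y x ∧ ((chart x).cov (W x) ∩ G.cov y).Nonempty},
      closure (G.jumpDomain W R y x)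

/-- The image in the background of `O`, a set in the orbit space of the chart at `x`, intersected
with `M(G)`. -/
def trace (x : X) (O : Set (chart x).Q) : Set G.M := {z | ∃ a ∈ O, G.Represents R z ⟨x, a⟩}

/-- The basic neighbourhoods of `z` given by a largest element `x` of `J_z`. -/
def basicNhds (z : G.M) (x : X) : Set (Set G.M) :=
  {B | ∃ O : Set (chart x).Q, IsOpen O ∧ O ⊆ G.baseDomain W R x ∧ G.trace R x O = B ∧ z ∈ B}

/-- The relative topology: a set is open if it contains basic neighbourhoods of each of its
points. -/
@[reducible] def relTopology : TopologicalSpace G.M :=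
  TopologicalSpace.mkOfNhds fun z =>
    ⨅ x ∈ {x | G.IsTopIndex W R z x}, ⨅ B ∈ G.basicNhds W R z x, 𝓟 B

/-- The relative topology is well defined and Hausdorff: each point `z` has a largest index in
`J_z`, for every choice of a largest index `x` the basic neighbourhoods of `z` form a
neighbourhood base of `z`, and the topology is Hausdorff. -/
def RelativelyHausdorff : Prop :=
  (∀ z : G.M, ∃ x, G.IsTopIndex W R z x) ∧
  (∀ (z : G.M) (x : X), G.IsTopIndex W R z x → ∀ N : Set G.M,
    N ∈ @nhds G.M (G.relTopology W R) z ↔ ∃ B ∈ G.basicNhds W R z x, B ⊆ N) ∧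
  @T2Space G.M (G.relTopology W R)

end Relative

/-- The topology `𝒯(G', G)` on `M(G')`. -/
@[reducible] def relTopologyIn (G' G : GoodCoordinateSystem chart) : TopologicalSpace G'.M :=
  G'.relTopology G.U G.ident

/-- `M(G')` is Hausdorff in `𝒯(G', G)`. -/
def RelativelyHausdorffIn (G' G : GoodCoordinateSystem chart) : Prop :=
  G'.RelativelyHausdorff G.U G.ident

end General

section ForKuranishi

variable {K : KuranishiStructure.{u, v} X}

/-- `G`, whose charts are restrictions of the charts of `K`, is a good coordinate system for the
Kuranishi structure `K`. -/
def IsFor (G : GoodCoordinateSystem K.chart) : Prop :=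
  ∀ (y : X) (hy : y ∈ G.S) (x : X) (hx : x ∈ G.S) (hle : G.le y x)
    (hne : (G.cov y ∩ G.cov x).Nonempty),
    (∀ h : y ∈ (K.chart x).cov univ,
      (G.change y hy x hx hle hne).IsRestriction (K.change x y h)) ∧
    (y ∉ (K.chart x).cov univ → ∃ h : x ∈ (K.chart y).cov univ,
      (K.chart y).dim = (K.chart x).dim ∧ (K.chart y).rank = (K.chart x).rank ∧
      Nat.card (K.chart y).G = Nat.card (K.chart x).G ∧
      (G.change y hy x hx hle hne).IsInverseOfRestriction (K.change y x h))

/-- Charts of `G` that meet in `M(K)` have coverages that meet (so that a coordinate change between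
them belongs to the data of `G`). -/
def StronglyIntersecting (G : GoodCoordinateSystem K.chart) : Prop :=
  ∀ y ∈ G.S, ∀ x ∈ G.S,
    (∃ a ∈ (K.chart y).orb (G.U y), ∃ b ∈ (K.chart x).orb (G.U x), K.ident ⟨y, a⟩ ⟨x, b⟩) →
    (G.cov y ∩ G.cov x).Nonempty

/-- `M(G) = M(K)|_G`: the coordinate changes of `G` and those of `K` induce the same relation on
the disjoint union of the orbit spaces of the charts of `G`. -/
def IdentificationMatching (G : GoodCoordinateSystem K.chart) : Prop :=
  G.ident.comap (Subtype.val : G.Pt → ChartPoint K.chart) =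
    K.ident.comap (Subtype.val : G.Pt → ChartPoint K.chart)

/-- The topology `𝒯(G, K)` on `M(G)`: the background is given by the full charts `C_x`, `x ∈ S`,
and the relation `∼` of `K`. -/
@[reducible] def relTopologyKur (G : GoodCoordinateSystem K.chart) : TopologicalSpace G.M :=
  G.relTopology (fun _ => univ) K.ident

/-- `M(G)` is Hausdorff in `𝒯(G, K)`. -/
def RelativelyHausdorffKur (G : GoodCoordinateSystem K.chart) : Prop :=
  G.RelativelyHausdorff (fun _ => univ) K.ident

end ForKuranishi

end GoodCoordinateSystem

end Kuranishi

/-!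
Write `Γ` for the set of pairs of points, in the orbit spaces of two charts, that are identified in
`M(K)`.  Identification preserves the property of lying over a given point of `X`, two points over
the same point of `X` are identified through the chart at that point, and by maximality an orbit space
injects into `M(K)`.  Topological matching says that a pair of zeros in the closure of `Γ`
belongs to `Γ`; everything else is a compactness argument based on this.

*Strong intersection suffices* (`GCSData.IsPre.toGCS`, `GCSData.IsPre.ident_iff`).  If charts that
meet in `M(K)` have coverages that meet, then by maximality each identification between two charts
is a single coordinate change, so the relations of `K` and of the system of charts agree, and
maximality and topological matching are inherited from `K`.

*Shrinking* (`GCSData.IsPre.exists_shrinking`).  Shrink the coverages to regular open sets such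
that closures meet only where the sets do already.  The zeros over disjoint closures
form compact sets whose product is disjoint from the closure of `Γ`; by the tube lemma they
have neighbourhoods that do not meet in `M(K)`.  Small charts around the zeros are thus strongly
intersecting.

*Existence* (`KuranishiStructure.exists_isPre`).  Take balls of radius `r x` as coverages, where the
ball of radius `2 * r x` is covered by the full chart, and order the charts by rank and then by
radius.  Then only coordinate changes of `K` itself are needed, no inverses.

*Relative topology* (`GoodCoordinateSystem.IsAdapted`).  Along a strong shrinking sequence the closed
charts shrink to compact sets of zeros.  Near pairs of identified zeros, `Γ` is the graph of a
continuous map and hence relatively closed, so for large `k` the set `Γ` is closed along the closures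
of the charts (`IsStrongShrinkingSeq.eventually_closure_graph`).  For a point `z` with representative
`a` in the chart of largest index `x`, this shows that `a` lies in `D_x`, that the points near `z`
have no indices but those of `z`, and that the coordinate changes to the chart at `x` are defined
near them.  Hence the sets traced by small neighbourhoods of `a` are open and form a
neighbourhood base of `z`, whatever the background is (`IsAdapted.nhds_eq`).  Two points with
representatives `a`, `b` that have no disjoint neighbourhoods give a pair `(a, b)` in the closure of
`Γ`, hence in `Γ`, and are equal.
-/

/-! ### The orbit space of a chart -/

namespace KuranishiChart

variable {X : Type u} [TopologicalSpace X] {p : X} (C : KuranishiChart.{u, v} X p)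

instance : Finite C.G := C.finite

instance : ContinuousConstSMul C.G C.V := ⟨fun g => (C.smooth_smul g).continuous⟩

instance : LocallyCompactSpace C.V := Manifold.locallyCompact_of_finiteDimensional C.I

theorem isOpenQuotientMap_quot : IsOpenQuotientMap C.quot :=
  MulAction.isOpenQuotientMap_quotientMk

theorem continuous_quot : Continuous C.quot := C.isOpenQuotientMap_quot.continuous

instance : T2Space C.Q := t2Space_of_properlyDiscontinuousSMul_of_t2Space

instance : SecondCountableTopology C.Q := ContinuousConstSMul.secondCountableTopology

instance : LocallyCompactSpace C.Q := C.isOpenQuotientMap_quot.locallyCompactSpace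

variable {C}

theorem quot_eq_iff {v w : C.V} : C.quot v = C.quot w ↔ ∃ g : C.G, g • w = v := by
  unfold quot
  rw [Quotient.eq'']
  exact MulAction.orbitRel_apply

@[simp] theorem quot_smul (g : C.G) (v : C.V) : C.quot (g • v) = C.quot v :=
  quot_eq_iff.2 ⟨g, rfl⟩

theorem Invariant.quot_mem_orb {U : Set C.V} (hU : C.Invariant U) {v : C.V} :
    C.quot v ∈ C.orb U ↔ v ∈ U := by
  constructor
  · rintro ⟨w, hw, h⟩
    obtain ⟨g, rfl⟩ := quot_eq_iff.1 h.symm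
    exact hU g w hw
  · exact fun h => ⟨v, h, rfl⟩

theorem invariant_preimage (O : Set C.Q) : C.Invariant (C.quot ⁻¹' O) := fun g v hv => by
  simpa using hv

theorem orb_preimage (O : Set C.Q) : C.orb (C.quot ⁻¹' O) = O :=
  image_preimage_eq _ C.isOpenQuotientMap_quot.surjective

theorem isOpen_orb {U : Set C.V} (hU : IsOpen U) : IsOpen (C.orb U) :=
  C.isOpenQuotientMap_quot.isOpenMap U hU

theorem Invariant.closure {U : Set C.V} (hU : C.Invariant U) : C.Invariant (closure U) :=
  fun g _ hv => map_mem_closure (continuous_const_smul g) hv fun w hw => hU g w hw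

/-- The quotient map by the finite group is proper. -/
theorem isCompact_preimage_quot {L : Set C.Q} (hL : IsCompact L) :
    IsCompact (C.quot ⁻¹' L) := by
  obtain ⟨T, hT⟩ : ∃ T : Set C.V, IsCompact T ∧ L ⊆ C.quot '' T := by
    choose N hN hNm using fun v : C.V => exists_compact_mem_nhds v
    obtain ⟨t, ht⟩ := hL.elim_nhds_subcover' (fun a _ => C.quot '' N (Quotient.out a))
      (fun a _ => by
        have := C.isOpenQuotientMap_quot.isOpenMap.image_mem_nhds (hNm (Quotient.out a))
        rwa [show C.quot (Quotient.out a) = a from Quotient.out_eq' a] at this)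
    refine ⟨⋃ a ∈ t, N (Quotient.out a.1), t.isCompact_biUnion fun a _ => hN _, ?_⟩
    simpa [image_iUnion] using ht
  have hc : IsCompact (⋃ g : C.G, (fun v : C.V => g • v) '' T) :=
    isCompact_iUnion fun g => hT.1.image (continuous_const_smul g)
  refine hc.of_isClosed_subset (hL.isClosed.preimage C.continuous_quot) fun v hv => ?_
  obtain ⟨w, hw, h⟩ := hT.2 hv
  obtain ⟨g, rfl⟩ := quot_eq_iff.1 h.symm
  exact mem_iUnion.2 ⟨g, w, hw, rfl⟩

theorem closure_orb_subset {U : Set C.V} (hU : IsCompact (_root_.closure U)) :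
    _root_.closure (C.orb U) ⊆ C.orb (_root_.closure U) :=
  closure_minimal (image_mono subset_closure) (hU.image C.continuous_quot).isClosed

/-- The zero section is closed: in a local trivialization it is the zero level of a continuous
map. -/
theorem isClosed_zeros : IsClosed C.zeros := by
  rw [← isOpen_compl_iff, isOpen_iff_mem_nhds]
  intro v hv
  set e := trivializationAt C.F C.E v with he
  have hlin : ∀ (w : C.V) (hw : w ∈ e.baseSet) (x : C.E w),
      (e (⟨w, x⟩ : C.Tot)).2 = e.continuousLinearEquivAt ℝ w hw x := fun w hw x => rfl
  have hcont : ContinuousAt (fun w => (e (⟨w, C.s w⟩ : C.Tot)).2) v := by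
    refine continuous_snd.continuousAt.comp ?_
    refine ContinuousAt.comp (g := e) ?_ C.smooth_s.continuous.continuousAt
    exact e.continuousOn.continuousAt (e.open_source.mem_nhds (by
      rw [e.mem_source]; exact mem_baseSet_trivializationAt _ _ v))
  have hne : (e (⟨v, C.s v⟩ : C.Tot)).2 ≠ 0 := by
    have hvb : v ∈ e.baseSet := mem_baseSet_trivializationAt _ _ v
    rw [hlin v hvb]
    exact (map_ne_zero_iff _ (ContinuousLinearEquiv.injective _)).2 hv
  filter_upwards [hcont.eventually_ne hne,
    e.open_baseSet.mem_nhds (mem_baseSet_trivializationAt _ _ v)] with w hw hwb hw0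
  apply hw
  rw [hlin w hwb, show C.s w = 0 from hw0, map_zero]

theorem smul_mem_zeros {g : C.G} {v : C.V} (hv : v ∈ C.zeros) : g • v ∈ C.zeros := by
  show C.s (g • v) = 0
  rw [← C.equivariant_s, show C.s v = 0 from hv, map_zero]

theorem invariant_zeros : C.Invariant C.zeros := fun _ _ hv => smul_mem_zeros hv

variable (C) in
/-- The point `a` of the orbit space is the orbit of a zero of the section, and it is sent to the
point `t` of `X`. -/
def LiesOver (a : C.Q) (t : X) : Prop := ∃ (v : C.V) (hv : v ∈ C.zeros), C.quot v = a ∧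
  C.foot v hv = t

theorem liesOver_quot_iff {v : C.V} {t : X} :
    C.LiesOver (C.quot v) t ↔ ∃ hv : v ∈ C.zeros, C.foot v hv = t := by
  constructor
  · rintro ⟨w, hw, h, rfl⟩
    obtain ⟨g, rfl⟩ := quot_eq_iff.1 h.symm
    refine ⟨smul_mem_zeros hw, ?_⟩
    unfold foot
    congr 2
    exact h.symm
  · rintro ⟨hv, rfl⟩
    exact ⟨v, hv, rfl, rfl⟩

theorem LiesOver.unique {a : C.Q} {t t' : X} (h : C.LiesOver a t) (h' : C.LiesOver a t') :
    t = t' := by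
  obtain ⟨v, hv, rfl, rfl⟩ := h
  obtain ⟨_, rfl⟩ := liesOver_quot_iff.1 h'
  rfl

theorem LiesOver.injective {a b : C.Q} {t : X} (h : C.LiesOver a t) (h' : C.LiesOver b t) :
    a = b := by
  obtain ⟨v, hv, rfl, rfl⟩ := h
  obtain ⟨w, hw, rfl, h⟩ := h'
  exact (congrArg Subtype.val (C.isOpenEmbedding_ψ.injective h)).symm

theorem mem_orb_zeros_iff {a : C.Q} : a ∈ C.orb C.zeros ↔ ∃ t, C.LiesOver a t :=
  ⟨fun ⟨v, hv, h⟩ => ⟨_, v, hv, h, rfl⟩, fun ⟨_, v, hv, h, _⟩ => ⟨v, hv, h⟩⟩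

theorem Invariant.mem_cov_iff {U : Set C.V} (hU : C.Invariant U) {t : X} :
    t ∈ C.cov U ↔ ∃ a ∈ C.orb U, C.LiesOver a t := by
  constructor
  · rintro ⟨v, hv, hvU, rfl⟩
    exact ⟨_, ⟨v, hvU, rfl⟩, v, hv, rfl, rfl⟩
  · rintro ⟨a, ha, v, hv, rfl, rfl⟩
    exact ⟨v, hv, hU.quot_mem_orb.1 ha, rfl⟩

theorem mem_cov_univ_iff {t : X} : t ∈ C.cov univ ↔ ∃ a, C.LiesOver a t := by
  rw [Invariant.mem_cov_iff (fun _ _ _ => mem_univ _)]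
  refine exists_congr fun a => and_iff_right ?_
  obtain ⟨v, rfl⟩ := C.isOpenQuotientMap_quot.surjective a
  exact ⟨v, mem_univ _, rfl⟩

theorem cov_mono {U U' : Set C.V} (h : U ⊆ U') : C.cov U ⊆ C.cov U' :=
  fun _ ⟨v, hv, hU, e⟩ => ⟨v, hv, h hU, e⟩

theorem base_mem_cov : p ∈ C.cov univ := by
  obtain ⟨⟨_, v, hv, rfl⟩, h⟩ := C.base_mem
  exact ⟨v, hv, mem_univ _, h⟩

theorem isClosed_orb_zeros : IsClosed (C.orb C.zeros) := by
  rw [← C.isOpenQuotientMap_quot.isQuotientMap.isClosed_preimage]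
  convert C.isClosed_zeros using 1
  ext v
  exact C.invariant_zeros.quot_mem_orb

variable (C) in
theorem setOf_liesOver_eq (T : Set X) :
    {a | ∃ t ∈ T, C.LiesOver a t} = Subtype.val '' (C.ψ ⁻¹' T) := by
  ext a
  constructor
  · rintro ⟨t, ht, v, hv, rfl, rfl⟩
    exact ⟨⟨_, v, hv, rfl⟩, ht, rfl⟩
  · rintro ⟨⟨_, v, hv, rfl⟩, ht, rfl⟩
    exact ⟨_, ht, v, hv, rfl, rfl⟩

theorem isClosed_liesOver {T : Set X} (hT : IsClosed T) :
    IsClosed {a | ∃ t ∈ T, C.LiesOver a t} := by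
  rw [setOf_liesOver_eq]
  exact (IsClosed.isClosedEmbedding_subtypeVal C.isClosed_orb_zeros).isClosedMap _
    (hT.preimage C.isOpenEmbedding_ψ.continuous)

theorem isCompact_liesOver {T : Set X} (hT : IsCompact T) (h : T ⊆ C.cov univ) :
    IsCompact {a | ∃ t ∈ T, C.LiesOver a t} := by
  rw [setOf_liesOver_eq]
  refine (C.isOpenEmbedding_ψ.isInducing.isCompact_preimage' hT fun t ht => ?_).image
    continuous_subtype_val
  obtain ⟨v, hv, -, rfl⟩ := h ht
  exact ⟨_, rfl⟩

theorem isOpen_cov {U : Set C.V} (hU : IsOpen U) (hi : C.Invariant U) : IsOpen (C.cov U) := by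
  have : C.cov U = C.ψ '' (Subtype.val ⁻¹' C.orb U) := by
    ext t
    rw [hi.mem_cov_iff]
    constructor
    · rintro ⟨a, ha, v, hv, rfl, rfl⟩
      exact ⟨⟨_, v, hv, rfl⟩, ha, rfl⟩
    · rintro ⟨⟨_, v, hv, rfl⟩, ht, rfl⟩
      exact ⟨_, ht, v, hv, rfl, rfl⟩
  rw [this]
  exact C.isOpenEmbedding_ψ.isOpenMap _ ((isOpen_orb hU).preimage continuous_subtype_val)

theorem mem_cov_preimage_iff {O : Set C.Q} {t : X} :
    t ∈ C.cov (C.quot ⁻¹' O) ↔ ∃ a ∈ O, C.LiesOver a t := by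
  rw [(invariant_preimage O).mem_cov_iff, orb_preimage]

/-- An open part `T` of the coverage is the coverage of a precompact open subset of the orbit space,
which can be chosen in any given neighbourhood `N` of the zeros over the closure of `T`. -/
theorem exists_isOpen_cov_eq {T : Set X} [CompactSpace X] (hT : IsOpen T)
    (hT' : closure T ⊆ C.cov univ)
    {N : Set C.Q} (hN : IsOpen N) (h : {a | ∃ t ∈ closure T, C.LiesOver a t} ⊆ N) :
    ∃ O : Set C.Q, IsOpen O ∧ IsCompact (closure O) ∧ closure O ⊆ N ∧
      C.cov (C.quot ⁻¹' O) = T := by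
  obtain ⟨O, hO, hZO, hON, hOc⟩ := exists_open_between_and_isCompact_closure
    (isCompact_liesOver isClosed_closure.isCompact hT') hN h
  have hsub : O \ {a | ∃ t ∈ Tᶜ, C.LiesOver a t} ⊆ O := sdiff_subset
  refine ⟨O \ {a | ∃ t ∈ Tᶜ, C.LiesOver a t}, hO.sdiff (isClosed_liesOver hT.isClosed_compl),
    hOc.of_isClosed_subset isClosed_closure (closure_mono hsub), (closure_mono hsub).trans hON, ?_⟩
  ext t
  rw [mem_cov_preimage_iff]
  constructor
  · rintro ⟨a, ⟨-, ha⟩, hat⟩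
    by_contra ht
    exact ha ⟨t, ht, hat⟩
  · intro ht
    obtain ⟨a, hat⟩ := mem_cov_univ_iff.1 (hT' (subset_closure ht))
    refine ⟨a, ⟨hZO ⟨t, subset_closure ht, hat⟩, ?_⟩, hat⟩
    rintro ⟨t', ht', hat'⟩
    exact ht' (hat.unique hat' ▸ ht)

end KuranishiChart

/-! ### Coordinate changes on orbit spaces -/

namespace CoordChange

variable {X : Type u} [TopologicalSpace X] {q p : X}
  {C : KuranishiChart.{u, v} X q} {D : KuranishiChart.{u, v} X p}
  {U : Set C.V} {W : Set D.V} (Φ : CoordChange C D U W)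

theorem quot_φ_smul (g : C.G) {v : C.V} (hv : v ∈ Φ.dom) :
    D.quot (Φ.φ (g • v)) = D.quot (Φ.φ v) := by
  obtain ⟨h, -, heq, -⟩ := Φ.equivariant
  have := congrArg TotalSpace.proj (heq g v hv 0)
  exact KuranishiChart.quot_eq_iff.2 ⟨h g, this.symm⟩

theorem φ_mem_zeros_iff {v : C.V} (hv : v ∈ Φ.dom) : Φ.φ v ∈ D.zeros ↔ v ∈ C.zeros := by
  show D.s (Φ.φ v) = 0 ↔ C.s v = 0
  rw [← Φ.map_s v hv, map_eq_zero_iff _ (Φ.injective_φhat v hv)]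

theorem liesOver_iff {v : C.V} (hv : v ∈ Φ.dom) {t : X} :
    D.LiesOver (D.quot (Φ.φ v)) t ↔ C.LiesOver (C.quot v) t := by
  rw [KuranishiChart.liesOver_quot_iff, KuranishiChart.liesOver_quot_iff]
  constructor
  · rintro ⟨hw, rfl⟩
    exact ⟨(Φ.φ_mem_zeros_iff hv).1 hw, (Φ.map_foot v hv _ hw).symm⟩
  · rintro ⟨hw, rfl⟩
    exact ⟨(Φ.φ_mem_zeros_iff hv).2 hw, Φ.map_foot v hv _ _⟩

theorem continuousOn_φ : ContinuousOn Φ.φ Φ.dom := Φ.smooth_φ.continuousOn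

/-- The quotiented coordinate change is continuous. -/
theorem exists_isOpen_quot {v : C.V} (hv : v ∈ Φ.dom) {O : Set D.Q} (hO : IsOpen O)
    (h : D.quot (Φ.φ v) ∈ O) :
    ∃ P : Set C.Q, IsOpen P ∧ C.quot v ∈ P ∧
      ∀ c ∈ P, ∃ w ∈ Φ.dom, C.quot w = c ∧ D.quot (Φ.φ w) ∈ O :=
  ⟨C.orb (Φ.dom ∩ Φ.φ ⁻¹' (D.quot ⁻¹' O)),
    KuranishiChart.isOpen_orb (Φ.continuousOn_φ.isOpen_inter_preimage Φ.isOpen_dom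
      (hO.preimage D.continuous_quot)), ⟨v, ⟨hv, h⟩, rfl⟩,
    fun _ ⟨w, hw, hc⟩ => ⟨w, hw.1, hc, hw.2⟩⟩

theorem rank_le (h : Φ.dom.Nonempty) : C.rank ≤ D.rank := by
  obtain ⟨v, hv⟩ := h
  let e := (trivializationAt C.F C.E v).continuousLinearEquivAt ℝ v
    (mem_baseSet_trivializationAt _ _ v)
  let e' := (trivializationAt D.F D.E (Φ.φ v)).continuousLinearEquivAt ℝ (Φ.φ v)
    (mem_baseSet_trivializationAt _ _ (Φ.φ v))
  have := LinearMap.finrank_le_finrank_of_injective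
    (f := e'.toLinearEquiv.toLinearMap ∘ₗ Φ.φhat v ∘ₗ e.symm.toLinearEquiv.toLinearMap)
    (e'.injective.comp ((Φ.injective_φhat v hv).comp e.symm.injective))
  simpa using this

/-- The restriction of a coordinate change to smaller charts. -/
def restrict {U' : Set C.V} {W' : Set D.V} (hU : IsOpen U') (hUi : C.Invariant U')
    (hW : IsOpen W') (hWi : D.Invariant W') : CoordChange C D U' W' where
  dom := Φ.dom ∩ Φ.φ ⁻¹' W' ∩ U'
  dom_subset := inter_subset_right
  isOpen_dom := (Φ.continuousOn_φ.isOpen_inter_preimage Φ.isOpen_dom hW).inter hU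
  invariant_dom := fun g v hv => ⟨⟨Φ.invariant_dom g v hv.1.1, by
    rw [mem_preimage, ← hWi.quot_mem_orb, Φ.quot_φ_smul g hv.1.1, hWi.quot_mem_orb]
    exact hv.1.2⟩, hUi g v hv.2⟩
  φ := Φ.φ
  φhat := Φ.φhat
  mapsTo := fun _ hv => hv.1.2
  smooth_φ := Φ.smooth_φ.mono fun _ hv => hv.1.1
  isEmbedding_φ := Φ.isEmbedding_φ.comp
    (IsEmbedding.inclusion fun _ (hv : _ ∈ Φ.dom ∩ Φ.φ ⁻¹' W' ∩ U') => hv.1.1)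
  injective_mfderiv := fun v hv => Φ.injective_mfderiv v hv.1.1
  smooth_φhat := Φ.smooth_φhat.mono fun _ hv => hv.1.1
  injective_φhat := fun v hv => Φ.injective_φhat v hv.1.1
  equivariant := by
    obtain ⟨h, hi, heq, hs⟩ := Φ.equivariant
    exact ⟨h, hi, fun g v hv => heq g v hv.1.1, fun v hv => hs v hv.1.1⟩
  injective_orb := fun v hv w hw => Φ.injective_orb v hv.1.1 w hw.1.1
  map_s := fun v hv => Φ.map_s v hv.1.1
  map_foot := fun v hv => Φ.map_foot v hv.1.1
  tangent := fun v hv => Φ.tangent v hv.1.1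

variable {Φ}

theorem IsRestriction.φ_eq {U' : Set C.V} {W' : Set D.V} {Ψ : CoordChange C D U' W'}
    (h : Ψ.IsRestriction Φ) {v : C.V} (hv : v ∈ Ψ.dom) : Ψ.φ v = Φ.φ v :=
  congrArg TotalSpace.proj (h.2 v hv 0)

theorem IsRestriction.trans {U' U'' : Set C.V} {W' W'' : Set D.V} {Ψ : CoordChange C D U' W'}
    {Θ : CoordChange C D U'' W''} (h' : Θ.IsRestriction Ψ) (h : Ψ.IsRestriction Φ)
    (hU : U'' ⊆ U') (hW : W'' ⊆ W') : Θ.IsRestriction Φ := by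
  have hle : ∀ v ∈ Θ.dom, v ∈ Ψ.dom := fun v hv => by rw [h'.1] at hv; exact hv.1.1
  refine ⟨?_, fun v hv e => (h'.2 v hv e).trans (h.2 v (hle v hv) e)⟩
  ext v
  constructor
  · intro hv
    have h1 := h.φ_eq (hle v hv)
    rw [h'.1] at hv
    have h2 : v ∈ Ψ.dom := hv.1.1
    rw [h.1] at h2
    exact ⟨⟨h2.1.1, by rw [mem_preimage, ← h1]; exact hv.1.2⟩, hv.2⟩
  · rintro ⟨⟨h1, h2⟩, h3⟩
    have h4 : v ∈ Ψ.dom := by rw [h.1]; exact ⟨⟨h1, hW h2⟩, hU h3⟩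
    rw [h'.1]
    exact ⟨⟨h4, by rw [mem_preimage, h.φ_eq h4]; exact h2⟩, h3⟩

theorem IsInverseOfRestriction.φ_eq {U' : Set C.V} {W' : Set D.V} {Ψ : CoordChange D C W' U'}
    (h : Ψ.IsInverseOfRestriction Φ) {v : C.V} (hv : v ∈ Φ.dom ∩ Φ.φ ⁻¹' W' ∩ U') :
    Ψ.φ (Φ.φ v) = v :=
  congrArg TotalSpace.proj (h.2 v hv 0)

theorem IsRestriction.inverse {U' U'' : Set C.V} {W' W'' : Set D.V} {Ψ : CoordChange D C W' U'}
    {Θ : CoordChange D C W'' U''} (h' : Θ.IsRestriction Ψ) (h : Ψ.IsInverseOfRestriction Φ)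
    (hU : U'' ⊆ U') (hW : W'' ⊆ W') : Θ.IsInverseOfRestriction Φ := by
  have hdom : Θ.dom = Φ.φ '' (Φ.dom ∩ Φ.φ ⁻¹' W'' ∩ U'') := by
    rw [h'.1, h.1]
    ext w
    constructor
    · rintro ⟨⟨⟨v, hv, rfl⟩, h2⟩, h3⟩
      rw [mem_preimage, h.φ_eq hv] at h2
      exact ⟨v, ⟨⟨hv.1.1, h3⟩, h2⟩, rfl⟩
    · rintro ⟨v, ⟨⟨h1, h2⟩, h3⟩, rfl⟩
      have hv : v ∈ Φ.dom ∩ Φ.φ ⁻¹' W' ∩ U' := ⟨⟨h1, hW h2⟩, hU h3⟩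
      exact ⟨⟨⟨v, hv, rfl⟩, by rw [mem_preimage, h.φ_eq hv]; exact h3⟩, h2⟩
  refine ⟨hdom, fun v hv e => ?_⟩
  have := h'.2 (Φ.φ v) (by rw [hdom]; exact ⟨v, hv, rfl⟩) (Φ.φhat v e)
  exact this.trans (h.2 v ⟨⟨hv.1.1, hW hv.1.2⟩, hU hv.2⟩ e)

end CoordChange

namespace CoordChange

variable {X : Type u} [TopologicalSpace X] {r q p : X} {B : KuranishiChart.{u, v} X r}
  {C : KuranishiChart.{u, v} X q} {D : KuranishiChart.{u, v} X p}

/-- Restrictions of compatible coordinate changes are compatible. -/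
theorem Compatible.restrict {U₁ U₂ U₁' U₂' : Set B.V} {W₁ W₂ W₁' W₂' : Set C.V}
    {Z₁ Z₂ Z₁' Z₂' : Set D.V} {Φ : CoordChange B C U₁ W₁}
    {Ψ : CoordChange C D W₂ Z₁} {Θ : CoordChange B D U₂ Z₂} (h : Φ.Compatible Ψ Θ)
    {Φ' : CoordChange B C U₁' W₁'} {Ψ' : CoordChange C D W₂' Z₁'} {Θ' : CoordChange B D U₂' Z₂'}
    (hΦ : Φ'.IsRestriction Φ) (hΨ : Ψ'.IsRestriction Ψ) (hΘ : Θ'.IsRestriction Θ) :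
    Φ'.Compatible Ψ' Θ' := by
  obtain ⟨g, hg⟩ := h
  refine ⟨g, fun v ⟨⟨h1, h2⟩, h3⟩ e => ?_⟩
  rw [hΘ.2 v h1 e, show Φ'.hat ⟨v, e⟩ = Φ.hat ⟨v, e⟩ from hΦ.2 v h2 e]
  rw [mem_preimage, hΦ.φ_eq h2] at h3
  rw [← hg v]
  · exact hΨ.2 _ h3 _
  · rw [hΘ.1] at h1
    rw [hΦ.1] at h2
    rw [hΨ.1] at h3
    exact ⟨⟨h1.1.1, h2.1.1⟩, h3.1.1⟩

end CoordChange

/-! ### The identification of points of a Kuranishi structure -/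

namespace KuranishiStructure

variable {X : Type u} [TopologicalSpace X] (K : KuranishiStructure.{u, v} X)

variable {K} in
theorem liesOver_iff_of_ident {a b : ChartPoint K.chart} (h : K.ident a b) (t : X) :
    (K.chart a.1).LiesOver a.2 t ↔ (K.chart b.1).LiesOver b.2 t := by
  induction h with
  | rel a b h =>
    obtain ⟨p, q, h, v, hv, rfl, rfl⟩ := h
    exact ((K.change p q h).liesOver_iff hv).symm
  | refl a => rfl
  | symm a b _ ih => exact ih.symm
  | trans a b c _ _ ih ih' => exact ih.trans ih'

variable {K}

theorem ident_of_change {p q : X} (h : q ∈ (K.chart p).cov univ) {v : (K.chart q).V}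
    (hv : v ∈ (K.change p q h).dom) :
    K.ident ⟨q, (K.chart q).quot v⟩ ⟨p, (K.chart p).quot ((K.change p q h).φ v)⟩ :=
  .rel _ _ ⟨p, q, h, v, hv, rfl, rfl⟩

/-- Two points that lie over the same point `t` of `X` are identified, through the chart at `t`. -/
theorem ident_of_liesOver {a b : ChartPoint K.chart} {t : X}
    (ha : (K.chart a.1).LiesOver a.2 t) (hb : (K.chart b.1).LiesOver b.2 t) : K.ident a b := by
  have key : ∀ c : ChartPoint K.chart, (K.chart c.1).LiesOver c.2 t →
      ∃ d : (K.chart t).Q, (K.chart t).LiesOver d t ∧ K.ident ⟨t, d⟩ c := by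
    rintro ⟨p, c⟩ hc
    have ht : t ∈ (K.chart p).cov univ := KuranishiChart.mem_cov_univ_iff.2 ⟨c, hc⟩
    obtain ⟨v, hv, hvd, hf⟩ := K.base_mem_dom p t ht
    have hvt : (K.chart t).LiesOver ((K.chart t).quot v) t := ⟨v, hv, rfl, hf⟩
    refine ⟨_, hvt, ?_⟩
    have : _ = c := (((K.change p t ht).liesOver_iff hvd).2 hvt).injective hc
    subst this
    exact ident_of_change ht hvd
  obtain ⟨d, hd, h⟩ := key a ha
  obtain ⟨d', hd', h'⟩ := key b hb
  rw [hd.injective hd'] at h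
  exact K.ident.trans (K.ident.symm h) h'

theorem exists_change_of_ident {p q : X} (h : q ∈ (K.chart p).cov univ) {a : (K.chart q).Q}
    {b : (K.chart p).Q} (hab : K.ident ⟨q, a⟩ ⟨p, b⟩) : ∃ v ∈ (K.change p q h).dom,
      (K.chart q).quot v = a ∧ (K.chart p).quot ((K.change p q h).φ v) = b := by
  obtain ⟨z, rfl⟩ := (K.chart q).isOpenQuotientMap_quot.surjective a
  obtain ⟨z', rfl⟩ := (K.chart p).isOpenQuotientMap_quot.surjective b
  obtain ⟨h1, h2⟩ := K.maximality p q h z z' hab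
  exact ⟨z, h1, rfl, h2⟩

theorem eq_of_ident {p : X} {a b : (K.chart p).Q} (h : K.ident ⟨p, a⟩ ⟨p, b⟩) : a = b := by
  obtain ⟨z, rfl⟩ := (K.chart p).isOpenQuotientMap_quot.surjective a
  obtain ⟨z', rfl⟩ := (K.chart p).isOpenQuotientMap_quot.surjective b
  exact (K.maximality p p KuranishiChart.base_mem_cov z z (K.ident.refl _)).2.symm.trans
    (K.maximality p p KuranishiChart.base_mem_cov z z' h).2

variable (K) in
/-- The pairs of points in the orbit spaces of the charts at `y` and at `x` that are identified. -/
def graph (y x : X) : Set ((K.chart y).Q × (K.chart x).Q) := {c | K.ident ⟨y, c.1⟩ ⟨x, c.2⟩}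

/-- Topological matching: over the zeros, the graph of the identification is closed. -/
theorem mem_graph_of_mem_closure {y x : X} {c : (K.chart y).Q × (K.chart x).Q}
    (hc : c ∈ closure (K.graph y x)) (h1 : c.1 ∈ (K.chart y).orb (K.chart y).zeros)
    (h2 : c.2 ∈ (K.chart x).orb (K.chart x).zeros) : c ∈ K.graph y x := by
  obtain ⟨w, hw, hlim⟩ := mem_closure_iff_seq_limit.1 hc
  exact K.topologicalMatching y x c.1 c.2 h1 h2 ⟨fun n => (w n).1, fun n => (w n).2, hw,
    (continuous_fst.tendsto c).comp hlim, (continuous_snd.tendsto c).comp hlim⟩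

theorem mem_closure_graph_swap {y x : X} {c : (K.chart y).Q × (K.chart x).Q} :
    c.swap ∈ closure (K.graph x y) ↔ c ∈ closure (K.graph y x) := by
  have : K.graph y x = Homeomorph.prodComm _ _ ⁻¹' K.graph x y := by
    ext c
    exact ⟨K.ident.symm, K.ident.symm⟩
  rw [this, ← (Homeomorph.prodComm _ _).preimage_closure]
  rfl

/-- The graph of the identification is closed in a neighbourhood of each point of the domain of a
coordinate change. -/
theorem mem_graph_of_mem_dom {y x : X} (h : y ∈ (K.chart x).cov univ)
    {c : (K.chart y).Q × (K.chart x).Q} (hc : c ∈ closure (K.graph y x))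
    (hd : c.1 ∈ (K.chart y).orb (K.change x y h).dom) : c ∈ K.graph y x := by
  obtain ⟨a, b⟩ := c
  obtain ⟨v, hv, rfl⟩ := hd
  suffices (K.chart x).quot ((K.change x y h).φ v) = b by
    subst this
    exact ident_of_change h hv
  by_contra hne
  obtain ⟨O', O, hO', hO, hbO', hbO, hdis⟩ := t2_separation hne
  obtain ⟨P, hP, hvP, hPO⟩ := (K.change x y h).exists_isOpen_quot hv hO' hbO'
  obtain ⟨⟨c, d⟩, ⟨hcP, hdO⟩, hcd⟩ := mem_closure_iff.1 hc _ (hP.prod hO) ⟨hvP, hbO⟩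
  obtain ⟨w, hw, rfl, hwO⟩ := hPO c hcP
  have := eq_of_ident (K.ident.trans (K.ident.symm hcd) (ident_of_change h hw))
  subst this
  exact hdis.le_bot ⟨hwO, hdO⟩

end KuranishiStructure

/-! ### Good coordinate systems from strong intersection -/

namespace GCSData

variable {X : Type u} [TopologicalSpace X] {K : KuranishiStructure.{u, v} X}

/-- The coordinate changes of `D` come from `K`: the condition of `GoodCoordinateSystem.IsFor`, stated
for systems of charts that are not yet known to be good coordinate systems. -/
def IsFor (D : GCSData K.chart) : Prop :=
  ∀ (y : X) (hy : y ∈ D.S) (x : X) (hx : x ∈ D.S) (hle : D.le y x)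
    (hne : (D.cov y ∩ D.cov x).Nonempty),
    (∀ h : y ∈ (K.chart x).cov univ,
      (D.change y hy x hx hle hne).IsRestriction (K.change x y h)) ∧
    (y ∉ (K.chart x).cov univ → ∃ h : x ∈ (K.chart y).cov univ,
      (K.chart y).dim = (K.chart x).dim ∧ (K.chart y).rank = (K.chart x).rank ∧
      Nat.card (K.chart y).G = Nat.card (K.chart x).G ∧
      (D.change y hy x hx hle hne).IsInverseOfRestriction (K.change y x h))

/-- Charts of `D` that meet in `M(K)` have coverages that meet. -/
def StronglyIntersecting (D : GCSData K.chart) : Prop :=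
  ∀ y ∈ D.S, ∀ x ∈ D.S,
    (∃ a ∈ (K.chart y).orb (D.U y), ∃ b ∈ (K.chart x).orb (D.U x), K.ident ⟨y, a⟩ ⟨x, b⟩) →
    (D.cov y ∩ D.cov x).Nonempty

/-- `D'` is a shrinking of `D`. -/
def IsShrinking (D' D : GCSData K.chart) : Prop :=
  D'.S = D.S ∧
  (∀ x ∈ D.S, ∀ y ∈ D.S, (D'.le y x ↔ D.le y x)) ∧
  (∀ x ∈ D.S, D'.U x ⊆ D.U x) ∧
  (∀ x ∈ D.S, ∀ y ∈ D.S, (D.cov y ∩ D.cov x).Nonempty → (D'.cov y ∩ D'.cov x).Nonempty) ∧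
  ∀ (y : X) (hy : y ∈ D.S) (hy' : y ∈ D'.S) (x : X) (hx : x ∈ D.S) (hx' : x ∈ D'.S)
    (hle : D.le y x) (hle' : D'.le y x) (hne : (D.cov y ∩ D.cov x).Nonempty)
    (hne' : (D'.cov y ∩ D'.cov x).Nonempty),
    (D'.change y hy' x hx' hle' hne').IsRestriction (D.change y hy x hx hle hne)

/-- A system of restricted charts and coordinate changes that satisfies the axioms of a good
coordinate system for `K`, except for those about the relation generated by its coordinate
changes (and for the condition on the zeros in the domains, which follows). -/
structure IsPre (D : GCSData K.chart) : Prop where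
  finite_S : D.S.Finite
  le_refl : ∀ x ∈ D.S, D.le x x
  le_trans : ∀ x ∈ D.S, ∀ y ∈ D.S, ∀ z ∈ D.S, D.le x y → D.le y z → D.le x z
  le_total : ∀ x ∈ D.S, ∀ y ∈ D.S, D.le x y ∨ D.le y x
  isOpen_U : ∀ x ∈ D.S, IsOpen (D.U x)
  invariant_U : ∀ x ∈ D.S, (K.chart x).Invariant (D.U x)
  base_mem : ∀ x ∈ D.S, x ∈ D.cov x
  cover : ∀ a : X, ∃ x ∈ D.S, a ∈ D.cov x
  le_of_rank_lt : ∀ y ∈ D.S, ∀ x ∈ D.S, (K.chart y).rank < (K.chart x).rank →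
    D.le y x ∧ ¬ D.le x y
  compatible : ∀ (z : X) (hz : z ∈ D.S) (y : X) (hy : y ∈ D.S) (x : X) (hx : x ∈ D.S)
    (hzy : D.le z y) (nzy : (D.cov z ∩ D.cov y).Nonempty)
    (hyx : D.le y x) (nyx : (D.cov y ∩ D.cov x).Nonempty)
    (hzx : D.le z x) (nzx : (D.cov z ∩ D.cov x).Nonempty),
    (D.change z hz y hy hzy nzy).Compatible (D.change y hy x hx hyx nyx)
      (D.change z hz x hx hzx nzx)
  isFor : D.IsFor

theorem IsFor.ident_of_change {D : GCSData K.chart} (hD : D.IsFor) {y : X} (hy : y ∈ D.S) {x : X}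
    (hx : x ∈ D.S) (hle : D.le y x) (hne : (D.cov y ∩ D.cov x).Nonempty) {v : (K.chart y).V}
    (hv : v ∈ (D.change y hy x hx hle hne).dom) :
    K.ident ⟨y, (K.chart y).quot v⟩
      ⟨x, (K.chart x).quot ((D.change y hy x hx hle hne).φ v)⟩ := by
  obtain ⟨h1, h2⟩ := hD y hy x hx hle hne
  by_cases h : y ∈ (K.chart x).cov univ
  · rw [(h1 h).φ_eq hv]
    rw [(h1 h).1] at hv
    exact KuranishiStructure.ident_of_change h hv.1.1
  · obtain ⟨h', -, -, -, hinv⟩ := h2 h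
    rw [hinv.1] at hv
    obtain ⟨w, hw, rfl⟩ := hv
    rw [hinv.φ_eq hw]
    exact K.ident.symm (KuranishiStructure.ident_of_change h' hw.1.1)

theorem IsFor.ident_le {D : GCSData K.chart} (hD : D.IsFor) {a b : ChartPoint K.chart}
    (h : D.ident a b) : K.ident a b := by
  induction h with
  | rel a b h =>
    obtain ⟨y, hy, x, hx, hle, hne, v, hv, rfl, rfl⟩ := h
    exact hD.ident_of_change hy hx hle hne hv
  | refl a => exact K.ident.refl _
  | symm a b _ ih => exact K.ident.symm ih
  | trans a b c _ _ ih ih' => exact K.ident.trans ih ih'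

/-- If the coverages of two charts meet, then every identification between the two charts in `K`
is given by the direct coordinate change, because of the maximality of the coordinate changes of
`K`. -/
theorem IsFor.exists_change_of_ident {D : GCSData K.chart} (hD : D.IsFor) {y : X} (hy : y ∈ D.S)
    {x : X} (hx : x ∈ D.S) (hle : D.le y x) (hne : (D.cov y ∩ D.cov x).Nonempty)
    (hyU : (K.chart y).Invariant (D.U y)) (hxU : (K.chart x).Invariant (D.U x))
    {a : (K.chart y).Q} {b : (K.chart x).Q}
    (ha : a ∈ (K.chart y).orb (D.U y)) (hb : b ∈ (K.chart x).orb (D.U x))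
    (h : K.ident ⟨y, a⟩ ⟨x, b⟩) : ∃ v ∈ (D.change y hy x hx hle hne).dom,
      (K.chart y).quot v = a ∧
        (K.chart x).quot ((D.change y hy x hx hle hne).φ v) = b := by
  obtain ⟨h1, h2⟩ := hD y hy x hx hle hne
  by_cases hyx : y ∈ (K.chart x).cov univ
  · obtain ⟨v, hv, rfl, rfl⟩ := KuranishiStructure.exists_change_of_ident hyx h
    rw [hyU.quot_mem_orb] at ha
    rw [hxU.quot_mem_orb] at hb
    have hv' : v ∈ (D.change y hy x hx hle hne).dom := by
      rw [(h1 hyx).1]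
      exact ⟨⟨hv, hb⟩, ha⟩
    exact ⟨v, hv', rfl, by rw [(h1 hyx).φ_eq hv']⟩
  · obtain ⟨h', -, -, -, hinv⟩ := h2 hyx
    obtain ⟨w, hw, rfl, rfl⟩ := KuranishiStructure.exists_change_of_ident h' (K.ident.symm h)
    rw [hyU.quot_mem_orb] at ha
    rw [hxU.quot_mem_orb] at hb
    have hw' : w ∈ (K.change y x h').dom ∩ (K.change y x h').φ ⁻¹' (D.U y) ∩ D.U x :=
      ⟨⟨hw, ha⟩, hb⟩
    refine ⟨(K.change y x h').φ w, ?_, rfl, by rw [hinv.φ_eq hw']⟩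
    rw [hinv.1]
    exact ⟨w, hw', rfl⟩

namespace IsPre

variable {D : GCSData K.chart} (hD : D.IsPre)
include hD

theorem mem_dom_of_ident {y : X} (hy : y ∈ D.S) {x : X} (hx : x ∈ D.S) (hle : D.le y x)
    (hne : (D.cov y ∩ D.cov x).Nonempty) {z : (K.chart y).V} (hz : z ∈ D.U y)
    {z' : (K.chart x).V} (hz' : z' ∈ D.U x)
    (h : K.ident ⟨y, (K.chart y).quot z⟩ ⟨x, (K.chart x).quot z'⟩) :
    z ∈ (D.change y hy x hx hle hne).dom ∧
      (K.chart x).quot ((D.change y hy x hx hle hne).φ z) = (K.chart x).quot z' := by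
  obtain ⟨v, hv, hvz, hvz'⟩ := hD.isFor.exists_change_of_ident hy hx hle hne
    (hD.invariant_U y hy) (hD.invariant_U x hx) ⟨z, hz, rfl⟩ ⟨z', hz', rfl⟩ h
  obtain ⟨g, rfl⟩ := KuranishiChart.quot_eq_iff.1 hvz.symm
  exact ⟨(D.change y hy x hx hle hne).invariant_dom g v hv,
    ((D.change y hy x hx hle hne).quot_φ_smul g hv).trans hvz'⟩

theorem ident_of_ident_of_meet {y : X} (hy : y ∈ D.S) {x : X} (hx : x ∈ D.S)
    (hne : (D.cov y ∩ D.cov x).Nonempty) {a : (K.chart y).Q} {b : (K.chart x).Q}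
    (ha : a ∈ (K.chart y).orb (D.U y)) (hb : b ∈ (K.chart x).orb (D.U x))
    (h : K.ident ⟨y, a⟩ ⟨x, b⟩) : D.ident ⟨y, a⟩ ⟨x, b⟩ := by
  rcases hD.le_total y hy x hx with hle | hle
  · obtain ⟨v, hv, rfl, rfl⟩ := hD.isFor.exists_change_of_ident hy hx hle hne
      (hD.invariant_U y hy) (hD.invariant_U x hx) ha hb h
    exact .rel _ _ ⟨y, hy, x, hx, hle, hne, v, hv, rfl, rfl⟩
  · rw [inter_comm] at hne
    obtain ⟨v, hv, rfl, rfl⟩ := hD.isFor.exists_change_of_ident hx hy hle hne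
      (hD.invariant_U x hx) (hD.invariant_U y hy) hb ha (K.ident.symm h)
    exact .symm _ _ (.rel _ _ ⟨x, hx, y, hy, hle, hne, v, hv, rfl, rfl⟩)

/-- If charts that meet in `M(K)` have coverages that meet, then `K` and the coordinate changes of
`D` identify the same points of the charts of `D`. -/
theorem ident_iff (hSI : D.StronglyIntersecting) {y : X} (hy : y ∈ D.S) {x : X} (hx : x ∈ D.S)
    {a : (K.chart y).Q} {b : (K.chart x).Q}
    (ha : a ∈ (K.chart y).orb (D.U y)) (hb : b ∈ (K.chart x).orb (D.U x)) :
    D.ident ⟨y, a⟩ ⟨x, b⟩ ↔ K.ident ⟨y, a⟩ ⟨x, b⟩ :=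
  ⟨hD.isFor.ident_le, fun h =>
    hD.ident_of_ident_of_meet hy hx (hSI y hy x hx ⟨a, ha, b, hb, h⟩) ha hb h⟩

/-- Strong intersection makes a system of charts a good coordinate system: its maximality and
topological matching are inherited from `K`. -/
def toGCS : GoodCoordinateSystem K.chart where
  toGCSData := D
  finite_S := hD.finite_S
  le_refl := hD.le_refl
  le_trans := hD.le_trans
  le_total := hD.le_total
  isOpen_U := hD.isOpen_U
  invariant_U := hD.invariant_U
  base_mem := hD.base_mem
  cover := hD.cover
  le_of_rank_lt := hD.le_of_rank_lt
  compatible := hD.compatible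
  foot_dom := by
    rintro y hy x hx hle hne z hz hzU ⟨-, z', hz', hzU', hf⟩
    exact (hD.mem_dom_of_ident hy hx hle hne hzU hzU'
      (KuranishiStructure.ident_of_liesOver (K := K) (a := ⟨y, _⟩) (b := ⟨x, _⟩)
        ⟨z, hz, rfl, rfl⟩ ⟨z', hz', rfl, hf⟩)).1
  maximality := fun y hy x hx hle hne z hz z' hz' h =>
    hD.mem_dom_of_ident hy hx hle hne hz hz' (hD.isFor.ident_le h)
  topologicalMatching := by
    rintro y hy x hx _ _ ⟨v, hv, rfl⟩ ⟨v', hv', rfl⟩ ⟨w, w', -, -, hw, h1, h2⟩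
    have h := K.topologicalMatching y x _ _ ⟨v, hv.1, rfl⟩ ⟨v', hv'.1, rfl⟩
      ⟨w, w', fun n => hD.isFor.ident_le (hw n), h1, h2⟩
    have hf := (KuranishiStructure.liesOver_iff_of_ident h _).1 ⟨v, hv.1, rfl, rfl⟩
    obtain ⟨_, hf'⟩ := KuranishiChart.liesOver_quot_iff.1 hf
    exact hD.ident_of_ident_of_meet hy hx ⟨_, ⟨v, hv.1, hv.2, rfl⟩, ⟨v', hv'.1, hv'.2, hf'⟩⟩
      ⟨v, hv.2, rfl⟩ ⟨v', hv'.2, rfl⟩ h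

end IsPre
end GCSData

/-! ### Shrinkings -/

/-- A finite open cover can be shrunk to regular open sets without losing the base points or any
of the intersections. -/
theorem exists_regular_shrinking {X : Type*} [TopologicalSpace X] [T4Space X]
    {S : Set X} (hS : S.Finite) (c : X → Set X) (hc : ∀ x ∈ S, IsOpen (c x))
    (hx : ∀ x ∈ S, x ∈ c x) (hcov : ∀ a, ∃ x ∈ S, a ∈ c x) :
    ∃ A : X → Set X, ∀ x ∈ S, A x = interior (closure (A x)) ∧ x ∈ A x ∧ closure (A x) ⊆ c x ∧
      (∀ a, ∃ x ∈ S, a ∈ A x) ∧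
      ∀ y ∈ S, (c y ∩ c x).Nonempty → (A y ∩ A x).Nonempty := by
  have : Finite S := hS
  obtain ⟨B, hBu, hBc, hBs⟩ := exists_iUnion_eq_closed_subset (u := fun x : S => c x)
    (fun x => hc x x.2) (fun _ => toFinite _)
    (eq_univ_of_forall fun a => by
      obtain ⟨x, h, ha⟩ := hcov a
      exact mem_iUnion.2 ⟨⟨x, h⟩, ha⟩)
  have hm : ∀ y x : X, ∃ t, (c y ∩ c x).Nonempty → t ∈ c y ∩ c x := fun y x => by
    by_cases h : (c y ∩ c x).Nonempty
    · exact ⟨h.some, fun _ => h.some_mem⟩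
    · exact ⟨y, fun h' => (h h').elim⟩
  choose m hm using hm
  -- the finitely many points that have to remain covered
  set F : X → Set X := fun x => insert x (((m · x) '' S ∪ m x '' S) ∩ c x) with hF
  have key : ∀ x ∈ S, ∃ O, IsOpen O ∧ F x ⊆ O ∧ (∀ h : x ∈ S, B ⟨x, h⟩ ⊆ O) ∧
      closure O ⊆ c x := by
    intro x h
    have hFc : IsClosed (F x) :=
      ((((hS.image _).union (hS.image _)).subset inter_subset_left).insert x).isClosed
    obtain ⟨O, hO, hsub, hcl⟩ := normal_exists_closure_subset (hFc.union (hBc ⟨x, h⟩)) (hc x h)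
      (union_subset (insert_subset (hx x h) inter_subset_right) (hBs ⟨x, h⟩))
    exact ⟨O, hO, subset_union_left.trans hsub, fun _ => subset_union_right.trans hsub, hcl⟩
  choose! O hO hFO hBO hOc using key
  have hOA : ∀ x ∈ S, O x ⊆ interior (closure (O x)) := fun x h =>
    interior_maximal subset_closure (hO x h)
  refine ⟨fun x => interior (closure (O x)), fun x h => ⟨interior_closure_idem.symm,
    hOA x h (hFO x h (mem_insert _ _)),
    (closure_minimal interior_subset isClosed_closure).trans (hOc x h), fun a => ?_, ?_⟩⟩
  · obtain ⟨y, hy⟩ := mem_iUnion.1 (hBu ▸ mem_univ a)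
    exact ⟨y, y.2, hOA y y.2 (hBO y y.2 y.2 hy)⟩
  · intro y hy hne
    have := hm y x hne
    exact ⟨m y x, hOA y hy (hFO y hy (.inr ⟨.inr ⟨x, h, rfl⟩, this.1⟩)),
      hOA x h (hFO x h (.inr ⟨.inl ⟨y, hy, rfl⟩, this.2⟩))⟩

namespace GCSData

variable {X : Type u} [TopologicalSpace X] {K : KuranishiStructure.{u, v} X}
  {D : GCSData K.chart}

theorem IsShrinking.trans {D' D'' : GCSData K.chart} (h' : D''.IsShrinking D')
    (h : D'.IsShrinking D) : D''.IsShrinking D := by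
  obtain ⟨hS, hle, hU, hI, hr⟩ := h
  obtain ⟨hS', hle', hU', hI', hr'⟩ := h'
  rw [hS] at hle' hU' hI'
  refine ⟨hS'.trans hS, fun x hx y hy => (hle' x hx y hy).trans (hle x hx y hy),
    fun x hx => (hU' x hx).trans (hU x hx), fun x hx y hy h => hI' x hx y hy (hI x hx y hy h), ?_⟩
  intro y hy hy' x hx hx' hl hl' hn hn'
  exact (hr' y (hS ▸ hy) hy' x (hS ▸ hx) hx' ((hle x hx y hy).2 hl) hl' (hI x hx y hy hn) hn').trans
    (hr y hy (hS ▸ hy) x hx (hS ▸ hx) hl ((hle x hx y hy).2 hl) hn (hI x hx y hy hn))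
    (hU' y hy) (hU' x hx)

theorem IsShrinking.meet_iff {D' : GCSData K.chart} (h : D'.IsShrinking D) {y x : X}
    (hy : y ∈ D.S) (hx : x ∈ D.S) :
    (D'.cov y ∩ D'.cov x).Nonempty ↔ (D.cov y ∩ D.cov x).Nonempty :=
  ⟨fun hn => hn.mono (inter_subset_inter (KuranishiChart.cov_mono (h.2.2.1 y hy))
    (KuranishiChart.cov_mono (h.2.2.1 x hx))), h.2.2.2.1 x hx y hy⟩

theorem IsShrinking.isFor {D' : GCSData K.chart} (h : D'.IsShrinking D) (hD : D.IsFor) :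
    D'.IsFor := by
  have hmeet := @h.meet_iff
  obtain ⟨hS, hle, hU, hI, hr⟩ := h
  intro y hy' x hx' hle' hne'
  have hy := hS ▸ hy'
  have hx := hS ▸ hx'
  have hl := (hle x hx y hy).1 hle'
  have hne := (hmeet hy hx).1 hne'
  obtain ⟨h1, h2⟩ := hD y hy x hx hl hne
  have hrest := hr y hy hy' x hx hx' hl hle' hne hne'
  refine ⟨fun h => hrest.trans (h1 h) (hU y hy) (hU x hx), fun h => ?_⟩
  obtain ⟨h', e1, e2, e3, hinv⟩ := h2 h
  exact ⟨h', e1, e2, e3, hrest.inverse hinv (hU x hx) (hU y hy)⟩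

theorem IsShrinking.stronglyIntersecting {D' : GCSData K.chart} (h : D'.IsShrinking D)
    (hD : D.StronglyIntersecting) : D'.StronglyIntersecting := by
  rintro y hy x hx ⟨a, ha, b, hb, hab⟩
  rw [h.1] at hy hx
  exact (h.meet_iff hy hx).2 (hD y hy x hx ⟨a, image_mono (h.2.2.1 y hy) ha, b,
    image_mono (h.2.2.1 x hx) hb, hab⟩)

/-- The restriction of `D` to smaller open invariant subsets of its charts. -/
def restrict (D : GCSData K.chart) (U' : ∀ x : X, Set (K.chart x).V) (hU : ∀ x ∈ D.S, U' x ⊆ D.U x)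
    (hUo : ∀ x ∈ D.S, IsOpen (U' x)) (hUi : ∀ x ∈ D.S, (K.chart x).Invariant (U' x)) :
    GCSData K.chart where
  S := D.S
  le := D.le
  U := U'
  change := fun y hy x hx hle hne =>
    (D.change y hy x hx hle (hne.mono (inter_subset_inter (KuranishiChart.cov_mono (hU y hy))
      (KuranishiChart.cov_mono (hU x hx))))).restrict (hUo y hy) (hUi y hy) (hUo x hx) (hUi x hx)

theorem restrict_isShrinking {U' : ∀ x : X, Set (K.chart x).V}
    (hU : ∀ x ∈ D.S, U' x ⊆ D.U x)
    (hUo : ∀ x ∈ D.S, IsOpen (U' x)) (hUi : ∀ x ∈ D.S, (K.chart x).Invariant (U' x))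
    (hI : ∀ x ∈ D.S, ∀ y ∈ D.S, (D.cov y ∩ D.cov x).Nonempty →
      ((K.chart y).cov (U' y) ∩ (K.chart x).cov (U' x)).Nonempty) :
    (D.restrict U' hU hUo hUi).IsShrinking D :=
  ⟨rfl, fun _ _ _ _ => Iff.rfl, hU, hI, fun _ _ _ _ _ _ _ _ _ _ =>
    ⟨rfl, fun _ _ _ => rfl⟩⟩

theorem restrict_isPre (hD : D.IsPre) {U' : ∀ x : X, Set (K.chart x).V}
    (hU : ∀ x ∈ D.S, U' x ⊆ D.U x)
    (hUo : ∀ x ∈ D.S, IsOpen (U' x)) (hUi : ∀ x ∈ D.S, (K.chart x).Invariant (U' x))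
    (hI : ∀ x ∈ D.S, ∀ y ∈ D.S, (D.cov y ∩ D.cov x).Nonempty →
      ((K.chart y).cov (U' y) ∩ (K.chart x).cov (U' x)).Nonempty)
    (hb : ∀ x ∈ D.S, x ∈ (K.chart x).cov (U' x))
    (hc : ∀ a, ∃ x ∈ D.S, a ∈ (K.chart x).cov (U' x)) :
    (D.restrict U' hU hUo hUi).IsPre where
  finite_S := hD.finite_S
  le_refl := hD.le_refl
  le_trans := hD.le_trans
  le_total := hD.le_total
  isOpen_U := hUo
  invariant_U := hUi
  base_mem := hb
  cover := hc
  le_of_rank_lt := hD.le_of_rank_lt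
  compatible := fun z hz y hy x hx hzy _ hyx _ hzx _ =>
    (hD.compatible z hz y hy x hx hzy _ hyx _ hzx _).restrict
      ⟨rfl, fun _ _ _ => rfl⟩
      ⟨rfl, fun _ _ _ => rfl⟩
      ⟨rfl, fun _ _ _ => rfl⟩
  isFor := (restrict_isShrinking hU hUo hUi hI).isFor hD.isFor

theorem IsPre.cov_isOpen (hD : D.IsPre) {x : X} (hx : x ∈ D.S) : IsOpen (D.cov x) :=
  KuranishiChart.isOpen_cov (hD.isOpen_U x hx) (hD.invariant_U x hx)

theorem IsPre.exists_regular_cover [T4Space X] (hD : D.IsPre) :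
    ∃ A : X → Set X, ∀ x ∈ D.S, A x = interior (closure (A x)) ∧ x ∈ A x ∧
      closure (A x) ⊆ D.cov x ∧ (∀ a, ∃ x ∈ D.S, a ∈ A x) ∧
      ∀ y ∈ D.S, (D.cov y ∩ D.cov x).Nonempty → (A y ∩ A x).Nonempty :=
  exists_regular_shrinking hD.finite_S D.cov (fun _ hx => hD.cov_isOpen hx) hD.base_mem hD.cover

/-- Zeros over disjoint compact subsets of `X` have neighbourhoods in the two orbit spaces between
which there are no identifications: by topological matching, the closure of the identification
contains no pair of such zeros. -/
theorem exists_isOpen_separating {y x : X} {T T' : Set X} (hT : IsCompact T) (hT' : IsCompact T')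
    (h : T ⊆ (K.chart y).cov univ) (h' : T' ⊆ (K.chart x).cov univ) (hTT : Disjoint T T') :
    ∃ (P : Set (K.chart y).Q) (P' : Set (K.chart x).Q), IsOpen P ∧ IsOpen P' ∧
      {a | ∃ t ∈ T, (K.chart y).LiesOver a t} ⊆ P ∧
      {a | ∃ t ∈ T', (K.chart x).LiesOver a t} ⊆ P' ∧
      ∀ a ∈ P, ∀ b ∈ P', ¬ K.ident ⟨y, a⟩ ⟨x, b⟩ := by
  obtain ⟨P, P', hP, hP', hTP, hTP', hsub⟩ := generalized_tube_lemma
    (KuranishiChart.isCompact_liesOver hT h) (KuranishiChart.isCompact_liesOver hT' h')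
    (n := (closure (K.graph y x))ᶜ) isClosed_closure.isOpen_compl (by
      rintro ⟨a, b⟩ ⟨⟨t, ht, hat⟩, ⟨t', ht', hbt⟩⟩ hmem
      have hg := KuranishiStructure.mem_graph_of_mem_closure hmem
        (KuranishiChart.mem_orb_zeros_iff.2 ⟨t, hat⟩)
        (KuranishiChart.mem_orb_zeros_iff.2 ⟨t', hbt⟩)
      have := ((KuranishiStructure.liesOver_iff_of_ident hg t).1 hat).unique hbt
      exact disjoint_left.1 hTT ht (this ▸ ht'))
  exact ⟨P, P', hP, hP', hTP, hTP', fun a ha b hb hab =>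
    hsub (mk_mem_prod ha hb) (subset_closure hab)⟩

/-- Shrinkings to prescribed coverages `A x`, close to the zeros: each chart of the shrinking is
precompact and lies in a given neighbourhood `N x` of the zeros. -/
theorem IsPre.exists_shrinking [CompactSpace X] [T2Space X] (hD : D.IsPre)
    {A : X → Set X}
    (hA : ∀ x ∈ D.S, A x = interior (closure (A x)) ∧ x ∈ A x ∧ closure (A x) ⊆ D.cov x ∧
      (∀ a, ∃ x ∈ D.S, a ∈ A x) ∧
      ∀ y ∈ D.S, (D.cov y ∩ D.cov x).Nonempty → (A y ∩ A x).Nonempty)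
    (N : ∀ x : X, Set (K.chart x).Q) (hN : ∀ x ∈ D.S, IsOpen (N x))
    (hNz : ∀ x ∈ D.S, (K.chart x).orb (K.chart x).zeros ⊆ N x) :
    ∃ G : GoodCoordinateSystem K.chart, G.IsFor ∧ G.StronglyIntersecting ∧
      G.toGCSData.IsShrinking D ∧ G.RegularCoverage ∧ ∀ x ∈ D.S, G.cov x = A x ∧
        IsCompact (closure (G.U x)) ∧ closure (G.U x) ⊆ D.U x ∧
        closure (G.U x) ⊆ (K.chart x).quot ⁻¹' N x := by
  have hAc : ∀ x ∈ D.S, closure (A x) ⊆ (K.chart x).cov univ := fun x hx =>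
    ((hA x hx).2.2.1).trans (KuranishiChart.cov_mono (subset_univ _))
  have hsep : ∀ y x : X, ∃ (P : Set (K.chart y).Q) (P' : Set (K.chart x).Q), y ∈ D.S → x ∈ D.S →
      IsOpen P ∧ IsOpen P' ∧
      {a | ∃ t ∈ closure (A y), (K.chart y).LiesOver a t} ⊆ P ∧
      {a | ∃ t ∈ closure (A x), (K.chart x).LiesOver a t} ⊆ P' ∧
      (¬ (D.cov y ∩ D.cov x).Nonempty → ∀ a ∈ P, ∀ b ∈ P', ¬ K.ident ⟨y, a⟩ ⟨x, b⟩) := by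
    intro y x
    by_cases h : y ∈ D.S ∧ x ∈ D.S ∧ ¬ (D.cov y ∩ D.cov x).Nonempty
    · obtain ⟨hy, hx, h⟩ := h
      obtain ⟨P, P', h1, h2, h3, h4, h5⟩ := exists_isOpen_separating
        (isClosed_closure (s := A y)).isCompact (isClosed_closure (s := A x)).isCompact
        (hAc y hy) (hAc x hx)
        ((disjoint_iff_inter_eq_empty.2 (not_nonempty_iff_eq_empty.1 h)).mono
          (hA y hy).2.2.1 (hA x hx).2.2.1)
      exact ⟨P, P', fun _ _ => ⟨h1, h2, h3, h4, fun _ => h5⟩⟩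
    · exact ⟨univ, univ, fun hy hx => ⟨isOpen_univ, isOpen_univ, subset_univ _, subset_univ _,
        fun h' => (h ⟨hy, hx, h'⟩).elim⟩⟩
  choose P P' hP using hsep
  have hO : ∀ x : X, ∃ O : Set (K.chart x).Q, x ∈ D.S → IsOpen O ∧ IsCompact (closure O) ∧
      closure O ⊆ (N x ∩ (K.chart x).orb (D.U x)) ∩ ⋂ y ∈ D.S, P x y ∩ P' y x ∧
      (K.chart x).cov ((K.chart x).quot ⁻¹' O) = A x := by
    intro x
    by_cases hx : x ∈ D.S
    swap
    · exact ⟨∅, fun h => (hx h).elim⟩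
    have hAo : IsOpen (A x) := by rw [(hA x hx).1]; exact isOpen_interior
    obtain ⟨O, hO⟩ := KuranishiChart.exists_isOpen_cov_eq hAo (hAc x hx)
      (N := (N x ∩ (K.chart x).orb (D.U x)) ∩ ⋂ y ∈ D.S, P x y ∩ P' y x)
      (((hN x hx).inter (KuranishiChart.isOpen_orb (hD.isOpen_U x hx))).inter
        (hD.finite_S.isOpen_biInter fun y hy => (hP x y hx hy).1.inter (hP y x hy hx).2.1)) (by
        rintro a ⟨t, ht, hat⟩
        refine ⟨⟨hNz x hx (KuranishiChart.mem_orb_zeros_iff.2 ⟨t, hat⟩), ?_⟩, ?_⟩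
        · obtain ⟨b, hb, hbt⟩ := (hD.invariant_U x hx).mem_cov_iff.1 ((hA x hx).2.2.1 ht)
          rwa [hat.injective hbt]
        · exact mem_iInter₂.2 fun y hy =>
            ⟨(hP x y hx hy).2.2.1 ⟨t, ht, hat⟩, (hP y x hy hx).2.2.2.1 ⟨t, ht, hat⟩⟩)
    exact ⟨O, fun _ => hO⟩
  choose O hO using hO
  set U' : ∀ x : X, Set (K.chart x).V := fun x => (K.chart x).quot ⁻¹' O x with hU'
  have hcl : ∀ x ∈ D.S, closure (U' x) ⊆ (K.chart x).quot ⁻¹' closure (O x) := fun x hx =>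
    (K.chart x).continuous_quot.closure_preimage_subset _
  have hclU : ∀ x ∈ D.S, closure (U' x) ⊆ D.U x := fun x hx v hv =>
    (hD.invariant_U x hx).quot_mem_orb.1 ((hO x hx).2.2.1 (hcl x hx hv)).1.2
  have hU : ∀ x ∈ D.S, U' x ⊆ D.U x := fun x hx => subset_closure.trans (hclU x hx)
  have hUo : ∀ x ∈ D.S, IsOpen (U' x) := fun x hx =>
    (hO x hx).1.preimage (K.chart x).continuous_quot
  have hUi : ∀ x ∈ D.S, (K.chart x).Invariant (U' x) := fun x _ =>
    KuranishiChart.invariant_preimage _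
  have hcov : ∀ x ∈ D.S, (K.chart x).cov (U' x) = A x := fun x hx => (hO x hx).2.2.2
  have hI : ∀ x ∈ D.S, ∀ y ∈ D.S, (D.cov y ∩ D.cov x).Nonempty →
      ((K.chart y).cov (U' y) ∩ (K.chart x).cov (U' x)).Nonempty := fun x hx y hy h => by
    rw [hcov x hx, hcov y hy]
    exact (hA x hx).2.2.2.2 y hy h
  have hpre : (D.restrict U' hU hUo hUi).IsPre := restrict_isPre hD hU hUo hUi hI
    (fun x hx => by rw [hcov x hx]; exact (hA x hx).2.1) (fun a => by
      obtain ⟨x, hx, -⟩ := hD.cover a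
      obtain ⟨y, hy, h⟩ := (hA x hx).2.2.2.1 a
      exact ⟨y, hy, by rwa [hcov y hy]⟩)
  have hSI : (D.restrict U' hU hUo hUi).StronglyIntersecting := by
    rintro y hy x hx ⟨a, ha, b, hb, hab⟩
    replace ha : a ∈ O y := by rwa [← (K.chart y).orb_preimage (O y)]
    replace hb : b ∈ O x := by rwa [← (K.chart x).orb_preimage (O x)]
    by_contra hne
    refine (hP y x hy hx).2.2.2.2 (fun h => hne (hI x hx y hy h)) a ?_ b ?_ hab
    · exact (mem_iInter₂.1 ((hO y hy).2.2.1 (subset_closure ha)).2 x hx).1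
    · exact (mem_iInter₂.1 ((hO x hx).2.2.1 (subset_closure hb)).2 y hy).2
  refine ⟨hpre.toGCS, hpre.isFor, hSI, restrict_isShrinking hU hUo hUi hI, fun x hx => ?_,
    fun x hx => ⟨hcov x hx, ?_, hclU x hx,
      fun v hv => ((hO x hx).2.2.1 (hcl x hx hv)).1.1⟩⟩
  · rw [show hpre.toGCS.cov x = A x from hcov x hx]
    exact (hA x hx).1
  · exact (KuranishiChart.isCompact_preimage_quot (hO x hx).2.1).of_isClosed_subset
      isClosed_closure (hcl x hx)

end GCSData

theorem GoodCoordinateSystem.isPre {X : Type u} [TopologicalSpace X]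
    {K : KuranishiStructure.{u, v} X} (G : GoodCoordinateSystem K.chart) (h : G.IsFor) :
    G.toGCSData.IsPre where
  finite_S := G.finite_S
  le_refl := G.le_refl
  le_trans := G.le_trans
  le_total := G.le_total
  isOpen_U := G.isOpen_U
  invariant_U := G.invariant_U
  base_mem := G.base_mem
  cover := G.cover
  le_of_rank_lt := G.le_of_rank_lt
  compatible := G.compatible
  isFor := h

/-! ### Existence of good coordinate systems and of shrinking sequences -/

section Existence

variable {X : Type u} [TopologicalSpace X] [CompactSpace X] [TopologicalSpace.MetrizableSpace X]

/-- A system of charts with direct coordinate changes.  The coverage of the chart at `x` is a ball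
of radius `r x` such that the concentric ball of radius `2 * r x` is covered by the full chart, and
charts are ordered by rank and then by `r`.  If the balls at `y` and `x` meet, then the centre of
the smaller one is covered by the full chart of the other, and the rank cannot decrease along the
resulting coordinate change of `K`; so this change goes from the smaller chart to the larger
one in the order. -/
theorem KuranishiStructure.exists_isPre (K : KuranishiStructure.{u, v} X) :
    ∃ D : GCSData K.chart, D.IsPre := by
  let := TopologicalSpace.metrizableSpaceMetric X
  have hr : ∀ x : X, ∃ r > 0, Metric.ball x (2 * r) ⊆ (K.chart x).cov univ := fun x => by
    obtain ⟨ε, hε, h⟩ := Metric.isOpen_iff.1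
      (KuranishiChart.isOpen_cov (C := K.chart x) isOpen_univ fun _ _ _ => mem_univ _) x
      KuranishiChart.base_mem_cov
    exact ⟨ε / 2, half_pos hε, by rwa [mul_div_cancel₀ ε two_ne_zero]⟩
  choose r hr0 hr using hr
  obtain ⟨S, -, hS⟩ := isCompact_univ.elim_nhds_subcover (fun x => Metric.ball x (r x))
    fun x _ => Metric.ball_mem_nhds x (hr0 x)
  set U : ∀ x : X, Set (K.chart x).V := fun x => (K.chart x).quot ⁻¹'
    {a | ∃ t ∈ (Metric.ball x (r x))ᶜ, (K.chart x).LiesOver a t}ᶜ with hU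
  have hUo : ∀ x, IsOpen (U x) := fun x => (KuranishiChart.isClosed_liesOver
    Metric.isOpen_ball.isClosed_compl).isOpen_compl.preimage (K.chart x).continuous_quot
  have hUi : ∀ x, (K.chart x).Invariant (U x) := fun x => KuranishiChart.invariant_preimage _
  have hcov : ∀ x, (K.chart x).cov (U x) = Metric.ball x (r x) := by
    intro x
    ext t
    rw [KuranishiChart.mem_cov_preimage_iff]
    constructor
    · rintro ⟨a, ha, hat⟩
      by_contra ht
      exact ha ⟨t, ht, hat⟩
    · intro ht
      obtain ⟨a, hat⟩ := KuranishiChart.mem_cov_univ_iff.1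
        (hr x (Metric.ball_subset_ball (by linarith [hr0 x]) ht))
      refine ⟨a, ?_, hat⟩
      rintro ⟨t', ht', hat'⟩
      exact ht' (hat.unique hat' ▸ ht)
  let le : X → X → Prop := fun y x => (K.chart y).rank < (K.chart x).rank ∨
    (K.chart y).rank = (K.chart x).rank ∧ r y ≤ r x
  have hmeet : ∀ y x : X, r y ≤ r x → ((K.chart y).cov (U y) ∩ (K.chart x).cov (U x)).Nonempty →
      y ∈ (K.chart x).cov univ := by
    rintro y x h ⟨t, hty, htx⟩
    rw [hcov, Metric.mem_ball] at hty htx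
    apply hr x
    rw [Metric.mem_ball]
    linarith [dist_triangle_left y x t]
  have key : ∀ y x : X, le y x → ((K.chart y).cov (U y) ∩ (K.chart x).cov (U x)).Nonempty →
      y ∈ (K.chart x).cov univ := by
    intro y x hle hne
    rcases le_or_gt (r y) (r x) with h | h
    · exact hmeet y x h hne
    · have hx := hmeet x y h.le (by rwa [inter_comm])
      obtain ⟨v, -, hv, -⟩ := K.base_mem_dom y x hx
      have := (K.change y x hx).rank_le ⟨v, hv⟩
      rcases hle with hle | ⟨-, hle⟩
      · exact absurd this hle.not_ge
      · exact absurd hle h.not_ge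
  refine ⟨{ S := S, le := le, U := U, change := fun y _ x _ hle hne =>
    (K.change x y (key y x hle hne)).restrict (hUo y) (hUi y) (hUo x) (hUi x) }, ?_⟩
  constructor
  case finite_S => exact S.finite_toSet
  case le_refl => exact fun x _ => .inr ⟨rfl, le_rfl⟩
  case le_trans =>
    rintro x - y - z - (h | ⟨h, h'⟩) (k | ⟨k, k'⟩)
    · exact .inl (h.trans k)
    · exact .inl (h.trans_eq k)
    · exact .inl (h.trans_lt k)
    · exact .inr ⟨h.trans k, h'.trans k'⟩
  case le_total =>
    intro x _ y _
    rcases lt_trichotomy (K.chart x).rank (K.chart y).rank with h | h | h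
    · exact .inl (.inl h)
    · exact (le_total (r x) (r y)).imp (fun h' => .inr ⟨h, h'⟩) (fun h' => .inr ⟨h.symm, h'⟩)
    · exact .inr (.inl h)
  case isOpen_U => exact fun x _ => hUo x
  case invariant_U => exact fun x _ => hUi x
  case base_mem => exact fun x _ => (hcov x).ge (Metric.mem_ball_self (hr0 x))
  case cover =>
    intro a
    obtain ⟨x, hx, ha⟩ := mem_iUnion₂.1 (hS (mem_univ a))
    exact ⟨x, hx, (hcov x).ge ha⟩
  case le_of_rank_lt =>
    refine fun y _ x _ h => ⟨.inl h, ?_⟩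
    rintro (h' | ⟨h', -⟩)
    · exact lt_asymm h h'
    · exact h.ne' h'
  case compatible =>
    exact fun z _ y _ x _ hzy nzy hyx nyx hzx nzx => (K.compatible x y z (key y x hyx nyx)
      (key z y hzy nzy) (key z x hzx nzx)).restrict ⟨rfl, fun _ _ _ => rfl⟩
        ⟨rfl, fun _ _ _ => rfl⟩ ⟨rfl, fun _ _ _ => rfl⟩
  case isFor =>
    exact fun y _ x _ hle hne => ⟨fun _ => ⟨rfl, fun _ _ _ => rfl⟩,
      fun h => absurd (key y x hle hne) h⟩

namespace GoodCoordinateSystem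

variable {K : KuranishiStructure.{u, v} X}

omit [CompactSpace X] [TopologicalSpace.MetrizableSpace X] in
theorem identificationMatching {G : GoodCoordinateSystem K.chart} (hG : G.IsFor)
    (hSI : G.StronglyIntersecting) : G.IdentificationMatching := by
  refine Setoid.ext fun a b => ?_
  exact (G.isPre hG).ident_iff hSI a.2.1 b.2.1 a.2.2 b.2.2

/-- A precompact shrinking, close to the zeros. -/
theorem exists_isPrecompactShrinking (G : GoodCoordinateSystem K.chart) (hG : G.IsFor)
    (N : ∀ x : X, Set (K.chart x).Q) (hN : ∀ x, IsOpen (N x))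
    (hNz : ∀ x, (K.chart x).orb (K.chart x).zeros ⊆ N x) :
    ∃ H : GoodCoordinateSystem K.chart, H.IsFor ∧ H.IsPrecompactShrinking G ∧
      ∀ x ∈ G.S, closure (H.U x) ⊆ (K.chart x).quot ⁻¹' N x := by
  obtain ⟨A, hA⟩ := (G.isPre hG).exists_regular_cover
  obtain ⟨H, h1, -, h3, h4, h5⟩ := (G.isPre hG).exists_shrinking hA N (fun x _ => hN x)
    (fun x _ => hNz x)
  exact ⟨H, h1, ⟨h3, fun x hx => ⟨(h5 x hx).2.1, (h5 x hx).2.2.1⟩, h4⟩,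
    fun x hx => (h5 x hx).2.2.2⟩

theorem exists_isStrongShrinkingSeq (G : GoodCoordinateSystem K.chart) (hG : G.IsFor) :
    ∃ H : ℕ → GoodCoordinateSystem K.chart, IsStrongShrinkingSeq H G := by
  -- neighbourhoods of the zeros that shrink to the zeros
  have hN : ∀ x : X, ∃ N : ℕ → Set (K.chart x).Q, (∀ n, IsOpen (N n)) ∧
      (∀ n, (K.chart x).orb (K.chart x).zeros ⊆ N n) ∧
      ⋂ n, N n ⊆ (K.chart x).orb (K.chart x).zeros := by
    intro x
    let := TopologicalSpace.metrizableSpaceMetric (K.chart x).Q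
    obtain ⟨O, hO, h⟩ := (KuranishiChart.isClosed_orb_zeros (C := K.chart x)).isGδ.eq_iInter_nat
    exact ⟨O, hO, fun n => h ▸ iInter_subset _ n, h.ge⟩
  choose N hNo hNz hN using hN
  have step : ∀ (n : ℕ) (H : {H : GoodCoordinateSystem K.chart // H.IsFor}),
      ∃ H' : {H : GoodCoordinateSystem K.chart // H.IsFor}, H'.1.IsPrecompactShrinking H.1 ∧
        ∀ x ∈ H.1.S, closure (H'.1.U x) ⊆ (K.chart x).quot ⁻¹' N x n := fun n H => by
    obtain ⟨H', h1, h2⟩ := exists_isPrecompactShrinking H.1 H.2 (fun x => N x n)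
      (fun x => hNo x n) (fun x => hNz x n)
    exact ⟨⟨H', h1⟩, h2⟩
  choose f hf hfN using step
  let H : ℕ → {H : GoodCoordinateSystem K.chart // H.IsFor} :=
    fun n => Nat.rec (f 0 ⟨G, hG⟩) (fun n H => f (n + 1) H) n
  have hsucc : ∀ k, (H (k + 1)).1.IsPrecompactShrinking (H k).1 := fun k => hf (k + 1) (H k)
  have hshr : ∀ k, (H k).1.IsShrinking G := fun k => by
    induction k with
    | zero => exact (hf 0 ⟨G, hG⟩).1
    | succ k ih => exact GCSData.IsShrinking.trans (hsucc k).1 ih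
  have hHN : ∀ k, ∀ x ∈ G.S, closure ((H k).1.U x) ⊆ (K.chart x).quot ⁻¹' N x k := fun k => by
    cases k with
    | zero => exact hfN 0 ⟨G, hG⟩
    | succ k => exact fun x hx => hfN (k + 1) (H k) x ((hshr k).1.symm ▸ hx)
  refine ⟨fun k => (H k).1, hshr, hf 0 ⟨G, hG⟩, hsucc, fun x hx v hv => subset_closure ⟨?_, ?_⟩⟩
  · exact (K.chart x).invariant_zeros.quot_mem_orb.1
      (hN x (mem_iInter.2 fun n => hHN n x hx (mem_iInter.1 hv n)))
  · exact ((hsucc 0).2.1 x ((hshr 0).1.symm ▸ hx)).2 (mem_iInter.1 hv 1)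

end GoodCoordinateSystem

end Existence

/-! ### Closedness of the identification on small charts -/

namespace GoodCoordinateSystem

variable {X : Type u} [TopologicalSpace X] {K : KuranishiStructure.{u, v} X}

/-- Along a strong shrinking sequence, the identification eventually has closed graph on the
closures of the charts.  The graph is closed in a neighbourhood of each pair of identified zeros,
where a coordinate change is defined, and the closures shrink to compact sets of zeros, where
topological matching applies. -/
theorem IsStrongShrinkingSeq.eventually_closure_graph {G : GoodCoordinateSystem K.chart}
    (hG : G.IsFor) {H : ℕ → GoodCoordinateSystem K.chart} (hH : IsStrongShrinkingSeq H G) :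
    ∀ᶠ k in atTop, ∀ y ∈ G.S, ∀ x ∈ G.S, closure (K.graph y x) ∩
      (K.chart y).orb (closure ((H k).U y)) ×ˢ (K.chart x).orb (closure ((H k).U x)) ⊆
        K.graph y x := by
  obtain ⟨hshr, h0, hsucc, hint⟩ := hH
  have hcpt : ∀ k, ∀ x ∈ G.S, IsCompact (closure ((H k).U x)) := fun k x hx => by
    cases k with
    | zero => exact (h0.2.1 x hx).1
    | succ k => exact ((hsucc k).2.1 x ((hshr k).1.symm ▸ hx)).1
  have hanti : ∀ x ∈ G.S, Antitone fun k => closure ((H k).U x) := fun x hx =>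
    antitone_nat_of_succ_le fun k =>
      (((hsucc k).2.1 x ((hshr k).1.symm ▸ hx)).2).trans subset_closure
  have hzero : ∀ x ∈ G.S, ∀ a : (K.chart x).Q, (∀ k, a ∈ (K.chart x).orb (closure ((H k).U x))) →
      a ∈ (K.chart x).orb (K.chart x).zeros := by
    intro x hx a ha
    obtain ⟨v, -, rfl⟩ := ha 0
    refine ⟨v, ?_, rfl⟩
    refine closure_minimal inter_subset_left KuranishiChart.isClosed_zeros
      (hint x hx (mem_iInter.2 fun k => ?_))
    have hinv : (K.chart x).Invariant (closure ((H k).U x)) :=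
      KuranishiChart.Invariant.closure ((H k).invariant_U x ((hshr k).1.symm ▸ hx))
    exact hinv.quot_mem_orb.1 (ha k)
  refine (eventually_all_finite G.finite_S).2 fun y hy =>
    (eventually_all_finite G.finite_S).2 fun x hx => ?_
  set C : ℕ → Set ((K.chart y).Q × (K.chart x).Q) := fun k => closure (K.graph y x) ∩
    (K.chart y).orb (closure ((H k).U y)) ×ˢ (K.chart x).orb (closure ((H k).U x)) with hC
  have hCanti : Antitone C := fun k l h => inter_subset_inter_right _
    (prod_mono (image_mono (hanti y hy h)) (image_mono (hanti x hx h)))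
  have hCcpt : ∀ k, IsCompact (C k) := fun k =>
    (((hcpt k y hy).image (K.chart y).continuous_quot).prod
      ((hcpt k x hx).image (K.chart x).continuous_quot)).inter_left isClosed_closure
  -- where one of the two coordinate changes of `K` between the charts is defined
  set O : Set ((K.chart y).Q × (K.chart x).Q) :=
    (⋃ h : y ∈ (K.chart x).cov univ, (K.chart y).orb (K.change x y h).dom ×ˢ univ) ∪
    ⋃ h : x ∈ (K.chart y).cov univ, univ ×ˢ (K.chart x).orb (K.change y x h).dom with hO
  have hOo : IsOpen O := (isOpen_iUnion fun h =>
      (KuranishiChart.isOpen_orb (K.change x y h).isOpen_dom).prod isOpen_univ).union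
    (isOpen_iUnion fun h =>
      isOpen_univ.prod (KuranishiChart.isOpen_orb (K.change y x h).isOpen_dom))
  have hOg : closure (K.graph y x) ∩ O ⊆ K.graph y x := by
    rintro ⟨a, b⟩ ⟨hc, h | h⟩
    · obtain ⟨h, hd⟩ := mem_iUnion.1 h
      exact KuranishiStructure.mem_graph_of_mem_dom h hc hd.1
    · obtain ⟨h, hd⟩ := mem_iUnion.1 h
      exact K.ident.symm (KuranishiStructure.mem_graph_of_mem_dom h (c := (b, a))
        (KuranishiStructure.mem_closure_graph_swap (c := (a, b)) |>.2 hc) hd.2)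
  have hCO : ∀ c ∈ ⋂ k, C k, O ∈ 𝓝 c := by
    rintro ⟨a, b⟩ hc
    rw [mem_iInter] at hc
    refine hOo.mem_nhds ?_
    have hab : K.ident ⟨y, a⟩ ⟨x, b⟩ := KuranishiStructure.mem_graph_of_mem_closure (hc 0).1
      (hzero y hy a fun k => (hc k).2.1) (hzero x hx b fun k => (hc k).2.2)
    obtain ⟨t, hat⟩ := KuranishiChart.mem_orb_zeros_iff.1 (hzero y hy a fun k => (hc k).2.1)
    have hbt : (K.chart x).LiesOver b t := (KuranishiStructure.liesOver_iff_of_ident hab t).1 hat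
    have hmeet : (G.cov y ∩ G.cov x).Nonempty :=
      ⟨t, (G.invariant_U y hy).mem_cov_iff.2 ⟨a, image_mono (h0.2.1 y hy).2 (hc 0).2.1, hat⟩,
        (G.invariant_U x hx).mem_cov_iff.2 ⟨b, image_mono (h0.2.1 x hx).2 (hc 0).2.2, hbt⟩⟩
    have hyx : y ∈ (K.chart x).cov univ ∨ x ∈ (K.chart y).cov univ := by
      rcases G.le_total y hy x hx with hle | hle
      · by_contra! hcon
        exact hcon.2 ((hG y hy x hx hle hmeet).2 hcon.1).1
      · by_contra! hcon
        exact hcon.1 ((hG x hx y hy hle (by rwa [inter_comm])).2 hcon.2).1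
    rcases hyx with h | h
    · obtain ⟨v, hv, rfl, -⟩ := KuranishiStructure.exists_change_of_ident h hab
      exact .inl (mem_iUnion.2 ⟨h, ⟨v, hv, rfl⟩, mem_univ _⟩)
    · obtain ⟨v, hv, rfl, -⟩ := KuranishiStructure.exists_change_of_ident h (K.ident.symm hab)
      exact .inr (mem_iUnion.2 ⟨h, mem_univ _, ⟨v, hv, rfl⟩⟩)
  obtain ⟨k, hk⟩ := exists_subset_nhds_of_isCompact' hCanti.directed_ge hCcpt
    (fun k => (hCcpt k).isClosed) hCO
  filter_upwards [eventually_ge_atTop k] with l hl c hc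
  exact hOg ⟨hc.1, hk (hCanti hl hc)⟩

end GoodCoordinateSystem

/-! ### The relative topology -/

namespace GoodCoordinateSystem

variable {X : Type u} [TopologicalSpace X] {K : KuranishiStructure.{u, v} X}

/-- The hypotheses under which the topology of `M(G)` relative to the background `(W, R)` is well
defined: `G` is a precompact part of a strongly intersecting good coordinate system `G₀` whose
charts lie in the background, the background identifies points of its charts as `K` does, and the
identification has closed graph on the closures of the charts of `G`. -/
structure IsAdapted (G G₀ : GoodCoordinateSystem K.chart) (W : ∀ x : X, Set (K.chart x).V)
    (R : Setoid (ChartPoint K.chart)) : Prop where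
  isFor : G₀.IsFor
  stronglyIntersecting : G₀.StronglyIntersecting
  matching : G.IdentificationMatching
  S_eq : G.S = G₀.S
  le_iff : ∀ x ∈ G.S, ∀ y ∈ G.S, (G.le y x ↔ G₀.le y x)
  isCompact_closure : ∀ x ∈ G.S, IsCompact (closure ((K.chart x).orb (G.U x)))
  closure_subset : ∀ x ∈ G.S, closure ((K.chart x).orb (G.U x)) ⊆ (K.chart x).orb (G₀.U x)
  subset_W : ∀ x ∈ G.S, G₀.U x ⊆ W x
  isOpen_W : ∀ x ∈ G.S, IsOpen (W x)
  ident_iff : ∀ y ∈ G.S, ∀ x ∈ G.S, ∀ a ∈ (K.chart y).orb (W y), ∀ b ∈ (K.chart x).orb (W x),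
    (R ⟨y, a⟩ ⟨x, b⟩ ↔ K.ident ⟨y, a⟩ ⟨x, b⟩)
  closure_graph : ∀ y ∈ G.S, ∀ x ∈ G.S, closure (K.graph y x) ∩
    closure ((K.chart y).orb (G.U y)) ×ˢ closure ((K.chart x).orb (G.U x)) ⊆ K.graph y x

namespace IsAdapted

variable {G G₀ : GoodCoordinateSystem K.chart} {W : ∀ x : X, Set (K.chart x).V}
  {R : Setoid (ChartPoint K.chart)}

theorem ident_of_represents (h : G.IsAdapted G₀ W R) {z : G.M} {a b : ChartPoint K.chart}
    (ha : G.Represents K.ident z a) (hb : G.Represents K.ident z b) : K.ident a b := by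
  obtain ⟨p, rfl, hp⟩ := ha
  obtain ⟨q, hq, hqb⟩ := hb
  have hqp := Quotient.exact hq
  change (G.ident.comap Subtype.val) q p at hqp
  rw [h.matching] at hqp
  exact K.ident.trans (K.ident.symm hp) (K.ident.trans (K.ident.symm hqp) hqb)

theorem eq_of_represents (h : G.IsAdapted G₀ W R) {z w : G.M} {a b : ChartPoint K.chart}
    (ha : G.Represents K.ident z a) (hb : G.Represents K.ident w b) (hab : K.ident a b) :
    z = w := by
  obtain ⟨p, rfl, hp⟩ := ha
  obtain ⟨q, rfl, hq⟩ := hb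
  refine Quotient.sound ?_
  change (G.ident.comap Subtype.val) p q
  rw [h.matching]
  exact K.ident.trans hp (K.ident.trans hab (K.ident.symm hq))

theorem represents_of_ident {z : G.M} {a b : ChartPoint K.chart}
    (ha : G.Represents K.ident z a) (hab : K.ident a b) : G.Represents K.ident z b := by
  obtain ⟨p, hp, hpa⟩ := ha
  exact ⟨p, hp, K.ident.trans hpa hab⟩

theorem eq_of_represents_same (h : G.IsAdapted G₀ W R) {z : G.M} {x : X} {a b : (K.chart x).Q}
    (ha : G.Represents K.ident z ⟨x, a⟩) (hb : G.Represents K.ident z ⟨x, b⟩) : a = b :=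
  KuranishiStructure.eq_of_ident (h.ident_of_represents ha hb)

theorem orb_subset_W (h : G.IsAdapted G₀ W R) {x : X} (hx : x ∈ G.S) :
    (K.chart x).orb (G.U x) ⊆ (K.chart x).orb (W x) :=
  (subset_closure.trans (h.closure_subset x hx)).trans (image_mono (h.subset_W x hx))

theorem represents_iff (h : G.IsAdapted G₀ W R) {z : G.M} {x : X} (hx : x ∈ G.S)
    {a : (K.chart x).Q} (ha : a ∈ (K.chart x).orb (W x)) :
    G.Represents R z ⟨x, a⟩ ↔ G.Represents K.ident z ⟨x, a⟩ :=
  exists_congr fun p => and_congr_right fun _ =>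
    h.ident_iff _ p.2.1 x hx _ (h.orb_subset_W p.2.1 p.2.2) a ha

theorem trace_eq (h : G.IsAdapted G₀ W R) {x : X} (hx : x ∈ G.S)
    {O : Set (K.chart x).Q} (hO : O ⊆ (K.chart x).orb (W x)) :
    G.trace R x O = G.trace K.ident x O := by
  ext z
  exact exists_congr fun a => and_congr_right fun ha => h.represents_iff hx (hO ha)

theorem mem_closureIndices_iff (h : G.IsAdapted G₀ W R) {z : G.M} {x : X} :
    x ∈ G.closureIndices W R z ↔ x ∈ G.S ∧ ∃ a ∈ closure ((K.chart x).orb (G.U x)),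
      G.Represents K.ident z ⟨x, a⟩ := by
  refine and_congr_right fun hx => exists_congr fun a => ?_
  constructor
  · rintro ⟨⟨ha, haW⟩, hr⟩
    exact ⟨ha, (h.represents_iff hx haW).1 hr⟩
  · rintro ⟨ha, hr⟩
    have haW := image_mono (h.subset_W x hx) (h.closure_subset x hx ha)
    exact ⟨⟨ha, haW⟩, (h.represents_iff hx haW).2 hr⟩

theorem exists_isTopIndex (h : G.IsAdapted G₀ W R) (z : G.M) : ∃ x, G.IsTopIndex W R z x := by
  have key : ∀ T : Set X, T.Finite → T ⊆ G.S → T.Nonempty → ∃ x ∈ T, ∀ y ∈ T, G.le y x := by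
    intro T hT
    induction T, hT using Set.Finite.induction_on with
    | empty => exact fun _ h => (not_nonempty_empty h).elim
    | @insert t T _ _ ih =>
      intro hS _
      have ht := hS (mem_insert t T)
      rcases T.eq_empty_or_nonempty with rfl | hne
      · refine ⟨t, mem_insert _ _, ?_⟩
        rintro y (rfl | hy)
        · exact G.le_refl y ht
        · exact hy.elim
      · obtain ⟨x, hx, hmax⟩ := ih ((subset_insert _ _).trans hS) hne
        have hxS := hS (mem_insert_of_mem _ hx)
        rcases G.le_total t ht x hxS with hle | hle
        · refine ⟨x, mem_insert_of_mem _ hx, ?_⟩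
          rintro y (rfl | hy)
          · exact hle
          · exact hmax y hy
        · refine ⟨t, mem_insert _ _, ?_⟩
          rintro y (rfl | hy)
          · exact G.le_refl y ht
          · exact G.le_trans y (hS (mem_insert_of_mem _ hy)) x hxS t ht (hmax y hy) hle
  obtain ⟨x, hx, hmax⟩ := key (G.closureIndices W R z) (G.finite_S.subset fun _ hx => hx.1)
    (fun _ hx => hx.1) (by
      obtain ⟨p, rfl⟩ := Quotient.exists_rep z
      exact ⟨p.1.1, h.mem_closureIndices_iff.2 ⟨p.2.1, p.1.2, subset_closure p.2.2, p, rfl,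
        K.ident.refl _⟩⟩)
  exact ⟨x, hx, hmax⟩

/-- On the closures of the charts of `G`, being identified with a point of the closure of the chart
at `y` is a closed condition, since that closure is compact. -/
theorem exists_ident_of_mem_closure (h : G.IsAdapted G₀ W R) {y : X} (hy : y ∈ G.S) {x : X}
    (hx : x ∈ G.S) {a : (K.chart x).Q} (ha : a ∈ closure ((K.chart x).orb (G.U x)))
    (hcl : a ∈ closure {c | ∃ b ∈ closure ((K.chart y).orb (G.U y)), K.ident ⟨x, c⟩ ⟨y, b⟩}) :
    ∃ b ∈ closure ((K.chart y).orb (G.U y)), K.ident ⟨x, a⟩ ⟨y, b⟩ := by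
  by_contra! hcon
  obtain ⟨u, v, hu, hv, hau, hLv, hsub⟩ := generalized_tube_lemma (isCompact_singleton (x := a))
    (h.isCompact_closure y hy) (n := (closure (K.graph x y))ᶜ) isClosed_closure.isOpen_compl (by
      rintro ⟨a', b⟩ ⟨rfl, hb⟩ hmem
      exact hcon b hb (h.closure_graph x hx y hy ⟨hmem, ha, hb⟩))
  obtain ⟨c, hcu, b, hb, hcb⟩ := mem_closure_iff.1 hcl u hu (hau rfl)
  exact hsub (mk_mem_prod hcu (hLv hb)) (subset_closure hcb)

theorem isOpen_baseDomain (h : G.IsAdapted G₀ W R) {x : X} (hx : x ∈ G.S) :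
    IsOpen (G.baseDomain W R x) :=
  (KuranishiChart.isOpen_orb (h.isOpen_W x hx)).sdiff
    ((G.finite_S.subset fun _ hy => hy.1).isClosed_biUnion fun _ _ => isClosed_closure)

/-- At a largest index, the representative avoids the closures of the domains of the coordinate
changes to larger charts: otherwise the limit in a larger chart would be a representative. -/
theorem mem_baseDomain (h : G.IsAdapted G₀ W R) {z : G.M} {x : X} (hx : G.IsTopIndex W R z x)
    {a : (K.chart x).Q} (ha : a ∈ closure ((K.chart x).orb (G.U x)))
    (hz : G.Represents K.ident z ⟨x, a⟩) : a ∈ G.baseDomain W R x := by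
  have hxS : x ∈ G.S := hx.1.1
  refine ⟨image_mono (h.subset_W x hxS) (h.closure_subset x hxS ha), fun hmem => ?_⟩
  obtain ⟨y, ⟨hy, -, hle, -⟩, hcl⟩ := mem_iUnion₂.1 hmem
  obtain ⟨b, hb, hab⟩ := h.exists_ident_of_mem_closure hy hxS ha (closure_mono (by
    rintro c ⟨hc, b, hb, hcb⟩
    exact ⟨b, subset_closure hb, (h.ident_iff x hxS y hy c hc b (h.orb_subset_W hy hb)).1 hcb⟩) hcl)
  exact hle (hx.2 y (h.mem_closureIndices_iff.2 ⟨hy, b, hb, represents_of_ident hz hab⟩))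

/-- Continuity of the coordinate changes of `G₀`, in terms of the identification. -/
theorem exists_isOpen_ident (h : G.IsAdapted G₀ W R) {y : X} (hy : y ∈ G.S) {x : X}
    (hx : x ∈ G.S) (hle : G.le y x) {a : (K.chart y).Q} {b : (K.chart x).Q}
    (ha : a ∈ (K.chart y).orb (G₀.U y)) (hb : b ∈ (K.chart x).orb (G₀.U x))
    (hab : K.ident ⟨y, a⟩ ⟨x, b⟩) {O : Set (K.chart x).Q} (hO : IsOpen O) (hbO : b ∈ O) :
    ∃ P, IsOpen P ∧ a ∈ P ∧ ∀ c ∈ P, ∃ d ∈ O, K.ident ⟨y, c⟩ ⟨x, d⟩ := by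
  rw [h.le_iff x hx y hy] at hle
  rw [h.S_eq] at hy hx
  have hne := h.stronglyIntersecting y hy x hx ⟨a, ha, b, hb, hab⟩
  obtain ⟨v, hv, rfl, rfl⟩ := GCSData.IsFor.exists_change_of_ident h.isFor hy hx hle hne
    (G₀.invariant_U y hy) (G₀.invariant_U x hx) ha hb hab
  obtain ⟨P, hP, hvP, hPO⟩ := (G₀.change y hy x hx hle hne).exists_isOpen_quot hv hO hbO
  refine ⟨P, hP, hvP, fun c hc => ?_⟩
  obtain ⟨w, hw, rfl, hwO⟩ := hPO c hc
  exact ⟨_, hwO, GCSData.IsFor.ident_of_change h.isFor hy hx hle hne hw⟩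

/-- Near a representative of `z`, only indices in `J_z` occur. -/
theorem exists_isOpen_closureIndices_subset (h : G.IsAdapted G₀ W R) {z : G.M} {x : X}
    (hx : x ∈ G.S) {a : (K.chart x).Q} (ha : a ∈ closure ((K.chart x).orb (G.U x)))
    (hz : G.Represents K.ident z ⟨x, a⟩) {O : Set (K.chart x).Q} (hO : IsOpen O) (haO : a ∈ O) :
    ∃ O' ⊆ O, IsOpen O' ∧ a ∈ O' ∧ ∀ w ∈ G.trace K.ident x O',
      G.closureIndices W R w ⊆ G.closureIndices W R z := by
  set B : X → Set (K.chart x).Q := fun y =>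
    closure {c | ∃ b ∈ closure ((K.chart y).orb (G.U y)), K.ident ⟨x, c⟩ ⟨y, b⟩} with hB
  refine ⟨O \ ⋃ y ∈ G.S \ G.closureIndices W R z, B y, sdiff_subset,
    hO.sdiff ((G.finite_S.subset sdiff_subset).isClosed_biUnion fun _ _ => isClosed_closure),
    ⟨haO, fun hmem => ?_⟩, ?_⟩
  · obtain ⟨y, ⟨hy, hyz⟩, hcl⟩ := mem_iUnion₂.1 hmem
    obtain ⟨b, hb, hab⟩ := h.exists_ident_of_mem_closure hy hx ha hcl
    exact hyz (h.mem_closureIndices_iff.2 ⟨hy, b, hb, represents_of_ident hz hab⟩)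
  · rintro w ⟨c, ⟨-, hc⟩, hwc⟩ y hyw
    by_contra hyz
    obtain ⟨hy, b, hb, hwb⟩ := h.mem_closureIndices_iff.1 hyw
    exact hc (mem_iUnion₂.2 ⟨y, ⟨hy, hyz⟩, subset_closure ⟨b, hb, h.ident_of_represents hwc hwb⟩⟩)

/-- A neighbourhood that is traced by an open set in the chart at `x` contains basic
neighbourhoods of its points with smaller largest index. -/
theorem exists_basic_subset (h : G.IsAdapted G₀ W R) {x : X} (hx : x ∈ G.S)
    {O : Set (K.chart x).Q} (hO : IsOpen O) (hO₀ : O ⊆ (K.chart x).orb (G₀.U x)) {w : G.M}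
    (hw : w ∈ G.trace K.ident x O) {y : X} (hy : G.IsTopIndex W R w y) (hle : G.le y x) :
    ∃ P, IsOpen P ∧ P ⊆ G.baseDomain W R y ∧ w ∈ G.trace K.ident y P ∧
      G.trace K.ident y P ⊆ G.trace K.ident x O := by
  obtain ⟨hyS, b, hb, hwb⟩ := h.mem_closureIndices_iff.1 hy.1
  obtain ⟨a, ha, hwa⟩ := hw
  obtain ⟨P, hP, hbP, hPO⟩ := h.exists_isOpen_ident hyS hx hle (h.closure_subset y hyS hb)
    (hO₀ ha) (h.ident_of_represents hwb hwa) hO ha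
  refine ⟨P ∩ G.baseDomain W R y, hP.inter (h.isOpen_baseDomain hyS), inter_subset_right,
    ⟨b, ⟨hbP, h.mem_baseDomain hy hb hwb⟩, hwb⟩, ?_⟩
  rintro w' ⟨c, hc, hwc⟩
  obtain ⟨d, hd, hcd⟩ := hPO c hc.1
  exact ⟨d, hd, represents_of_ident hwc hcd⟩

theorem trace_mem_basicNhds (h : G.IsAdapted G₀ W R) {x : X} (hx : x ∈ G.S)
    {O : Set (K.chart x).Q} (hO : IsOpen O) (hOD : O ⊆ G.baseDomain W R x) {z : G.M}
    (hz : z ∈ G.trace K.ident x O) : G.trace K.ident x O ∈ G.basicNhds W R z x :=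
  ⟨O, hO, hOD, h.trace_eq hx (hOD.trans sdiff_subset), hz⟩

theorem trace_mono {x : X} {O O' : Set (K.chart x).Q} (hO : O ⊆ O') :
    G.trace K.ident x O ⊆ G.trace K.ident x O' := fun _ ⟨a, ha, h⟩ => ⟨a, hO ha, h⟩

/-- The neighbourhoods of `z` in the relative topology are traced by the neighbourhoods of its
representative in the chart of largest index.  This description does not depend on the
background. -/
theorem nhds_eq (h : G.IsAdapted G₀ W R) {z : G.M} {x : X} (hx : G.IsTopIndex W R z x)
    {a : (K.chart x).Q} (ha : a ∈ closure ((K.chart x).orb (G.U x)))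
    (hz : G.Represents K.ident z ⟨x, a⟩) :
    @nhds G.M (G.relTopology W R) z = (𝓝 a).lift' (G.trace K.ident x) := by
  have hxS : x ∈ G.S := hx.1.1
  have hopen₀ : ∀ y ∈ G.S, IsOpen ((K.chart y).orb (G₀.U y)) := fun y hy =>
    KuranishiChart.isOpen_orb (G₀.isOpen_U y (h.S_eq ▸ hy))
  have hmono : Monotone (G.trace K.ident x) := fun _ _ => trace_mono
  let := G.relTopology W R
  refine le_antisymm ?_ ?_
  · intro N hN
    obtain ⟨O, hO, hON⟩ := (mem_lift'_sets hmono).1 hN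
    obtain ⟨O₁, hO₁, hO₁o, haO₁⟩ := mem_nhds_iff.1
      (inter_mem hO ((hopen₀ x hxS).mem_nhds (h.closure_subset x hxS ha)))
    obtain ⟨O₂, hO₂, hO₂o, haO₂, hind⟩ :=
      h.exists_isOpen_closureIndices_subset hxS ha hz hO₁o haO₁
    refine mem_nhds_iff.2 ⟨G.trace K.ident x O₂,
      (trace_mono (hO₂.trans (hO₁.trans inter_subset_left))).trans hON, ?_, ⟨a, haO₂, hz⟩⟩
    intro w hw
    obtain ⟨y, hy⟩ := h.exists_isTopIndex w
    obtain ⟨P, hP, hPD, hwP, hPsub⟩ := h.exists_basic_subset hxS hO₂o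
      (hO₂.trans (hO₁.trans inter_subset_right)) hw hy (hx.2 y (hind w hw hy.1))
    refine mem_iInf_of_mem y (mem_iInf_of_mem hy (mem_iInf_of_mem (G.trace K.ident y P)
      (mem_iInf_of_mem (h.trace_mem_basicNhds hy.1.1 hP hPD hwP) hPsub)))
  · intro N hN
    obtain ⟨V, hVN, hV, hzV⟩ := mem_nhds_iff.1 hN
    refine mem_of_superset ?_ hVN
    have hVz : V ∈ ⨅ y ∈ {y | G.IsTopIndex W R z y}, ⨅ B ∈ G.basicNhds W R z y, 𝓟 B := hV z hzV
    suffices (𝓝 a).lift' (G.trace K.ident x) ≤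
        ⨅ y ∈ {y | G.IsTopIndex W R z y}, ⨅ B ∈ G.basicNhds W R z y, 𝓟 B from this hVz
    refine le_iInf₂ fun y hy => le_iInf₂ fun B hB => le_principal_iff.2 ?_
    obtain ⟨O, hO, hOD, rfl, hzO⟩ := hB
    rw [h.trace_eq hy.1.1 (hOD.trans sdiff_subset)] at hzO ⊢
    obtain ⟨b, hbO, hzb⟩ := hzO
    obtain ⟨hyS, b', hb', hzb'⟩ := h.mem_closureIndices_iff.1 hy.1
    obtain rfl := h.eq_of_represents_same hzb hzb'
    obtain ⟨P, hP, -, ⟨a', ha', hza'⟩, hPsub⟩ := h.exists_basic_subset hyS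
      (hO.inter (hopen₀ y hyS)) inter_subset_right
      ⟨b, ⟨hbO, h.closure_subset y hyS hb'⟩, hzb⟩ hx (hy.2 x hx.1)
    obtain rfl := h.eq_of_represents_same hz hza'
    exact (mem_lift'_sets hmono).2 ⟨P, hP.mem_nhds ha', hPsub.trans (trace_mono inter_subset_left)⟩

theorem relativelyHausdorff (h : G.IsAdapted G₀ W R) : G.RelativelyHausdorff W R := by
  refine ⟨h.exists_isTopIndex, ?_, ?_⟩
  · intro z x hx N
    obtain ⟨hxS, a, ha, hz⟩ := h.mem_closureIndices_iff.1 hx.1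
    rw [h.nhds_eq hx ha hz, mem_lift'_sets fun _ _ => trace_mono]
    constructor
    · rintro ⟨O, hO, hON⟩
      obtain ⟨O', hO', hO'o, haO'⟩ := mem_nhds_iff.1
        (inter_mem hO ((h.isOpen_baseDomain hxS).mem_nhds (h.mem_baseDomain hx ha hz)))
      exact ⟨_, h.trace_mem_basicNhds hxS hO'o (hO'.trans inter_subset_right) ⟨a, haO', hz⟩,
        (trace_mono (hO'.trans inter_subset_left)).trans hON⟩
    · rintro ⟨_, ⟨O, hO, hOD, rfl, hzO⟩, hON⟩
      rw [h.trace_eq hxS (hOD.trans sdiff_subset)] at hzO hON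
      obtain ⟨b, hb, hzb⟩ := hzO
      obtain rfl := h.eq_of_represents_same hz hzb
      exact ⟨O, hO.mem_nhds hb, hON⟩
  · let := G.relTopology W R
    refine t2Space_iff_disjoint_nhds.2 fun z w hzw => ?_
    obtain ⟨x, hx⟩ := h.exists_isTopIndex z
    obtain ⟨y, hy⟩ := h.exists_isTopIndex w
    obtain ⟨hxS, a, ha, hz⟩ := h.mem_closureIndices_iff.1 hx.1
    obtain ⟨hyS, b, hb, hw⟩ := h.mem_closureIndices_iff.1 hy.1
    rw [h.nhds_eq hx ha hz, h.nhds_eq hy hb hw]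
    have hab : (a, b) ∉ closure (K.graph x y) := fun hcl =>
      hzw (h.eq_of_represents hz hw (h.closure_graph x hxS y hyS ⟨hcl, ha, hb⟩))
    obtain ⟨O, hO, P, hP, hOP⟩ := mem_nhds_prod_iff.1
      (isClosed_closure.isOpen_compl.mem_nhds hab)
    refine Filter.disjoint_iff.2 ⟨_, mem_lift' hO, _, mem_lift' hP, disjoint_left.2 ?_⟩
    rintro t ⟨c, hc, htc⟩ ⟨d, hd, htd⟩
    exact hOP (mk_mem_prod hc hd) (subset_closure (h.ident_of_represents htc htd))

theorem relTopology_eq (h : G.IsAdapted G₀ W R) {W' : ∀ x : X, Set (K.chart x).V}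
    {R' : Setoid (ChartPoint K.chart)} (h' : G.IsAdapted G₀ W' R') :
    G.relTopology W R = G.relTopology W' R' := by
  refine TopologicalSpace.ext_nhds fun z => ?_
  obtain ⟨x, hx⟩ := h.exists_isTopIndex z
  obtain ⟨-, a, ha, hz⟩ := h.mem_closureIndices_iff.1 hx.1
  have hx' : G.IsTopIndex W' R' z x := ⟨h'.mem_closureIndices_iff.2
    (h.mem_closureIndices_iff.1 hx.1), fun y hy => hx.2 y (h.mem_closureIndices_iff.2
      (h'.mem_closureIndices_iff.1 hy))⟩
  rw [h.nhds_eq hx ha hz, h'.nhds_eq hx' ha hz]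

end IsAdapted

theorem IsStrongShrinkingSeq.eventually_isAdapted {G : GoodCoordinateSystem K.chart}
    (hG : G.IsFor) (hSI : G.StronglyIntersecting)
    {H : ℕ → GoodCoordinateSystem K.chart} (hH : IsStrongShrinkingSeq H G) :
    ∀ᶠ k in atTop, (H k).IsFor ∧ (H k).StronglyIntersecting ∧
      (H k).IsAdapted G G.U G.ident ∧ (H k).IsAdapted G (fun _ => univ) K.ident := by
  have hsub : ∀ k, ∀ x ∈ G.S, IsCompact (closure ((H k).U x)) ∧
      closure ((H k).U x) ⊆ G.U x := fun k x hx => by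
    cases k with
    | zero => exact hH.2.1.2.1 x hx
    | succ k =>
      have := (hH.2.2.1 k).2.1 x ((hH.1 k).1.symm ▸ hx)
      exact ⟨this.1, this.2.trans ((hH.1 k).2.2.1 x hx)⟩
  filter_upwards [hH.eventually_closure_graph hG] with k hk
  obtain ⟨hS, hle, hU, hI, hr⟩ := hH.1 k
  have hFor : (H k).IsFor := GCSData.IsShrinking.isFor (hH.1 k) hG
  have hSI' : (H k).StronglyIntersecting := GCSData.IsShrinking.stronglyIntersecting (hH.1 k) hSI
  have hcl : ∀ x ∈ G.S, closure ((K.chart x).orb ((H k).U x)) ⊆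
      (K.chart x).orb (closure ((H k).U x)) := fun x hx =>
    KuranishiChart.closure_orb_subset (hsub k x hx).1
  have main : ∀ (W : ∀ x : X, Set (K.chart x).V) (R : Setoid (ChartPoint K.chart)),
      (∀ x ∈ G.S, G.U x ⊆ W x) → (∀ x ∈ G.S, IsOpen (W x)) →
      (∀ y ∈ G.S, ∀ x ∈ G.S, ∀ a ∈ (K.chart y).orb (W y), ∀ b ∈ (K.chart x).orb (W x),
        (R ⟨y, a⟩ ⟨x, b⟩ ↔ K.ident ⟨y, a⟩ ⟨x, b⟩)) → (H k).IsAdapted G W R := by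
    intro W R h1 h2 h3
    rw [← hS] at h1 h2 h3 hle hcl hk
    exact
    { isFor := hG
      stronglyIntersecting := hSI
      matching := identificationMatching hFor hSI'
      S_eq := hS
      le_iff := hle
      isCompact_closure := fun x hx =>
        (((hsub k x (hS ▸ hx)).1).image (K.chart x).continuous_quot).of_isClosed_subset
          isClosed_closure (hcl x hx)
      closure_subset := fun x hx => (hcl x hx).trans (image_mono (hsub k x (hS ▸ hx)).2)
      subset_W := h1
      isOpen_W := h2
      ident_iff := h3
      closure_graph := fun y hy x hx => (inter_subset_inter_right _
        (prod_mono (hcl y hy) (hcl x hx))).trans (hk y hy x hx) }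
  refine ⟨hFor, hSI', main _ _ (fun _ _ => Subset.rfl) G.isOpen_U
    fun y hy x hx a ha b hb => (G.isPre hG).ident_iff hSI hy hx ha hb,
    main _ _ (fun _ _ => subset_univ _) (fun _ _ => isOpen_univ) fun _ _ _ _ _ _ _ _ => Iff.rfl⟩

end GoodCoordinateSystem

theorem mainTheorem2 {X : Type u} [TopologicalSpace X] [CompactSpace X]
    [TopologicalSpace.MetrizableSpace X] (K : KuranishiStructure.{u, v} X) :
    -- strongly intersecting shrinkings
    (∀ G : GoodCoordinateSystem K.chart, G.IsFor → G.RegularCoverage →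
      ∃ G' : GoodCoordinateSystem K.chart, G'.IsFor ∧ G'.IsShrinking G ∧ G'.RegularCoverage ∧
        (∀ x ∈ G.S, x ∈ G'.cov x ∧ closure (G'.cov x) ⊆ G.cov x) ∧
        G'.StronglyIntersecting) ∧
    -- existence of a strongly intersecting, identification-matching good coordinate system
    (∃ G : GoodCoordinateSystem K.chart, G.IsFor ∧ G.IdentificationMatching ∧
      G.StronglyIntersecting ∧ G.RegularCoverage) ∧
    -- strong shrinking sequences exist, and lead to Hausdorff relative topologies
    (∀ G : GoodCoordinateSystem K.chart, G.IsFor → G.IdentificationMatching →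
      G.StronglyIntersecting → G.RegularCoverage →
      (∃ H : ℕ → GoodCoordinateSystem K.chart, GoodCoordinateSystem.IsStrongShrinkingSeq H G) ∧
      ∀ H : ℕ → GoodCoordinateSystem K.chart, GoodCoordinateSystem.IsStrongShrinkingSeq H G →
        ∀ᶠ k in Filter.atTop,
          (H k).IsFor ∧ (H k).IdentificationMatching ∧ (H k).StronglyIntersecting ∧
          (H k).RelativelyHausdorffIn G ∧ (H k).RelativelyHausdorffKur ∧
          (H k).relTopologyIn G = (H k).relTopologyKur) ∧
    -- the resulting good coordinate system
    (∃ G : GoodCoordinateSystem K.chart, G.IsFor ∧ G.StronglyIntersecting ∧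
      G.IdentificationMatching ∧ G.RelativelyHausdorffKur) := by
  have shrink : ∀ D : GCSData K.chart, D.IsPre → ∃ G : GoodCoordinateSystem K.chart, G.IsFor ∧
      G.toGCSData.IsShrinking D ∧ G.RegularCoverage ∧
      (∀ x ∈ D.S, x ∈ G.cov x ∧ closure (G.cov x) ⊆ D.cov x) ∧ G.StronglyIntersecting := by
    intro D hD
    obtain ⟨A, hA⟩ := hD.exists_regular_cover
    obtain ⟨G, h1, h2, h3, h4, h5⟩ := hD.exists_shrinking hA (fun _ => univ)
      (fun _ _ => isOpen_univ) (fun _ _ => subset_univ _)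
    refine ⟨G, h1, h3, h4, fun x hx => ?_, h2⟩
    rw [(h5 x hx).1]
    exact ⟨(hA x hx).2.1, (hA x hx).2.2.1⟩
  obtain ⟨D, hD⟩ := K.exists_isPre
  obtain ⟨G₀, hFor, -, hreg, -, hSI⟩ := shrink D hD
  have hlarge : ∀ G : GoodCoordinateSystem K.chart, G.IsFor → G.StronglyIntersecting →
      ∀ H : ℕ → GoodCoordinateSystem K.chart, GoodCoordinateSystem.IsStrongShrinkingSeq H G →
        ∀ᶠ k in Filter.atTop,
          (H k).IsFor ∧ (H k).IdentificationMatching ∧ (H k).StronglyIntersecting ∧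
          (H k).RelativelyHausdorffIn G ∧ (H k).RelativelyHausdorffKur ∧
          (H k).relTopologyIn G = (H k).relTopologyKur := by
    intro G hG hSI H hH
    filter_upwards [hH.eventually_isAdapted hG hSI] with k hk
    obtain ⟨h1, h2, h3, h4⟩ := hk
    exact ⟨h1, h3.matching, h2, h3.relativelyHausdorff, h4.relativelyHausdorff,
      h3.relTopology_eq h4⟩
  refine ⟨fun G hG _ => shrink G.toGCSData (G.isPre hG),
    ⟨G₀, hFor, GoodCoordinateSystem.identificationMatching hFor hSI, hSI, hreg⟩,
    fun G hG _ hSI _ => ⟨G.exists_isStrongShrinkingSeq hG, hlarge G hG hSI⟩, ?_⟩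
  obtain ⟨H, hH⟩ := G₀.exists_isStrongShrinkingSeq hFor
  obtain ⟨k, h1, h2, h3, -, h4, -⟩ := (hlarge G₀ hFor hSI H hH).exists
  exact ⟨H k, h1, h3, h2, h4⟩
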